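/- Let $N\in\mathbb N$, $m_i\in(0,\infty)$ and $a_i,b_i\in[0,\infty)$ for $i\in[N]:=\{1,\dots,N\}$, and let $\mathbb X_N=\{x\in\mathbb Z^N: x_1\le\cdots\le x_N\}$. The elastic particle system $X=(X(t))_{t\ge 0}$ is the (right-continuous) continuous-time Markov chain on $\mathbb X_N$, started from a deterministic $X(0)=x_0\in\mathbb X_N$, in which, from state $x$, coordinate $i$ decreases by $1$ at rate $A_i(x)$ and increases by $1$ at rate $B_i(x)$, where $$A_i(x)=\mathbf 1\{x_{i-1}<x_i\}\sum_{j=i}^N\frac{m_ja_j}{m_i}\mathbf 1\{x_j=x_i\},\qquad B_i(x)=\mathbf 1\{x_{i+1}>x_i\}\sum_{j=1}^i\frac{m_jb_j}{m_i}\mathbf 1\{x_j=x_i\},$$ with $x_0=-\infty$, $x_{N+1}=+\infty$ in these formulas. Let $\tau_0=0$ and $\tau_{n+1}=\inf\{t\ge\tau_n: X(t)\ne X(\tau_n)\}$ be the jump times of $X$. Put $M_k=\sum_{i=1}^k m_i$ and $U_k=-\sum_{i=1}^k m_i(b_i-a_i)$ for $0\le k\le N$, and let $\overline u:[0,M_N]\to\mathbb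 R$ be the least continuous concave function with $U_k\le\overline u(M_k)$ for all $0\le k\le N$. Write $\{k\in\{0,\dots,N\}:U_k=\overline u(M_k)\}=\{k_0<k_1<\cdots<k_\nu\}$ (so that $k_0=0$ and $k_\nu=N$). For $1\le j\le\nu$ let $\mathfrak C_j=\{i\in[N]:k_{j-1}<i\le k_j\}$ be the $j$-th cloud and $v_j=(U_{k_j}-U_{k_{j-1}})/(M_{k_j}-M_{k_{j-1}})$ its slope. For $\nu\ge2$ let $$L(n)=\min_{i\in\mathfrak C_\nu}X_i(\tau_n)-\max_{i'\in\mathfrak C_1}X_{i'}(\tau_n),\qquad n\in\mathbb Z_+,$$ be the gap between the two extreme clouds at the $n$-th jump time. For every $\gamma\in(0,1/2)$ there exists $\varepsilon_0=\varepsilon_0(\gamma)>0$ such that the following holds. Suppose that $\sum_{i\in\mathfrak C_j}(a_i+b_i)>0$ for every $1\le j\le\nu$, that $\nu\ge2$, and that $v_1=\cdots=v_\nu$. Then for every $\varepsilon\in(0,\varepsilon_0)$ and all $n$ sufficiently large (depending on $N$, the $m_i,a_i,b_i$, $x_0$, $\gamma$ and $\varepsilon$), $$\Pr\Bigl[\sum_{i=0}^n\mathbf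 1\{L(i)\le n^\gamma\}>n^{\frac12+\gamma+5\varepsilon}\Bigr]\le e^{-n^\varepsilon}.$$ -/

import Mathlib

open Set Filter MeasureTheory
open scoped NNReal ENNReal

namespace ElasticParticles

/-! Particles carry the labels `i : Fin N`, so the particle called `i` here is the `(i+1)`-st
particle from the left. Masses are `m`, intrinsic jump rates to the left and right are `a`, `b`. -/

/-- The configuration space: weakly increasing vectors of `N` integer positions. -/
abbrev Config (N : ℕ) : Type := {x : Fin N → ℤ // Monotone x}

/-- Rate at which particle `i` jumps one step to the left in configuration `x`: zero unless `i` has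
the smallest label in its stack, and then the sum of `m_j a_j / m_i` over the stack. -/
noncomputable def leftRate {N : ℕ} (m a : Fin N → ℝ) (x : Config N) (i : Fin N) : ℝ :=
  open Classical in
  if ∀ j : Fin N, (j : ℕ) + 1 = i → x.1 j < x.1 i then
    ∑ j : Fin N, if i ≤ j ∧ x.1 j = x.1 i then m j * a j / m i else 0
  else 0

/-- Rate at which particle `i` jumps one step to the right in configuration `x`: zero unless `i` has
the largest label in its stack, and then the sum of `m_j b_j / m_i` over the stack. -/
noncomputable def rightRate {N : ℕ} (m b : Fin N → ℝ) (x : Config N) (i : Fin N) : ℝ :=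
  open Classical in
  if ∀ j : Fin N, (j : ℕ) = i + 1 → x.1 i < x.1 j then
    ∑ j : Fin N, if j ≤ i ∧ x.1 j = x.1 i then m j * b j / m i else 0
  else 0

/-- The rate of the transition from configuration `x` to configuration `y ≠ x`. -/
noncomputable def jumpRate {N : ℕ} (m a b : Fin N → ℝ) (x y : Config N) : ℝ :=
  open Classical in
  ∑ i : Fin N, ((if y.1 = x.1 - Pi.single i 1 then leftRate m a x i else 0) +
    (if y.1 = x.1 + Pi.single i 1 then rightRate m b x i else 0))

/-- The total jump rate out of configuration `x`. -/
noncomputable def totalRate {N : ℕ} (m a b : Fin N → ℝ) (x : Config N) : ℝ :=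
  ∑ i : Fin N, (leftRate m a x i + rightRate m b x i)

/-- The successive jump times of a path `X` indexed by `ℝ≥0`: `τ 0 = 0`, and `τ (n+1)` is the
infimum of the times `t ≥ τ n` with `X t ≠ X (τ n)` (it is `∞` if there is no such time). -/
noncomputable def jumpTime {S : Type*} (X : ℝ≥0 → S) : ℕ → ℝ≥0∞
  | 0 => 0
  | n + 1 => ⨅ t : {t : ℝ≥0 // jumpTime X n ≤ t ∧ X t ≠ X (jumpTime X n).toNNReal}, (t.1 : ℝ≥0∞)

/-- The state `X (τ n)` of a path at its `n`-th jump time (meaningful when `τ n < ∞`). -/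
noncomputable def atJump {S : Type*} (X : ℝ≥0 → S) (n : ℕ) : S :=
  X (jumpTime X n).toNNReal

/-- `X` is, under `μ`, the elastic particle system started from `x₀`: the continuous-time Markov
chain on `Config N` with right-continuous paths, initial state `x₀` and transition rates
`jumpRate m a b`. The law is given through the jump chain and the holding times: the
sequence `X (τ 0), X (τ 1), …` is a Markov chain from `x₀` with transition probabilities
`jumpRate x y / totalRate x`, and given this sequence the holding times `τ (k+1) - τ k` are
independent exponential variables of rates `totalRate (X (τ k))`. (If `totalRate x = 0` the
formula makes `x` absorbing.) -/
structure IsElasticSystem {N : ℕ} (m a b : Fin N → ℝ) (x₀ : Config N) {Ω : Type*}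
    [MeasurableSpace Ω] (μ : Measure Ω) (X : ℝ≥0 → Ω → Config N) : Prop where
  measurable : ∀ t, Measurable (X t)
  right_continuous : ∀ ω t, ContinuousWithinAt (fun s => X s ω) (Ici t) t
  law : ∀ (n : ℕ) (y : ℕ → Config N) (t : ℕ → ℝ≥0),
    μ {ω | X 0 ω = y 0 ∧ ∀ k < n,
        jumpTime (X · ω) k + t k < jumpTime (X · ω) (k + 1) ∧
        jumpTime (X · ω) (k + 1) < ∞ ∧
        atJump (X · ω) (k + 1) = y (k + 1)} =
      (open Classical in if y 0 = x₀ then 1 else 0) *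
        ∏ k ∈ Finset.range n, ENNReal.ofReal
          (jumpRate m a b (y k) (y (k + 1)) / totalRate m a b (y k) *
            Real.exp (-(totalRate m a b (y k) * t k)))

/-- `M_k`, the total mass of the first `k` particles. -/
noncomputable def cumMass {N : ℕ} (m : Fin N → ℝ) (k : ℕ) : ℝ :=
  ∑ i : Fin N, if (i : ℕ) < k then m i else 0

/-- `U_k`, minus the sum of `m_i (b_i - a_i)` over the first `k` particles. -/
noncomputable def potential {N : ℕ} (m a b : Fin N → ℝ) (k : ℕ) : ℝ :=
  -∑ i : Fin N, if (i : ℕ) < k then m i * (b i - a i) else 0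

/-- `u` is, on `[0, M_N]`, a continuous concave majorant of the points `(M_k, U_k)`, `0 ≤ k ≤ N`. -/
def IsConcaveMajorant {N : ℕ} (m a b : Fin N → ℝ) (u : ℝ → ℝ) : Prop :=
  ContinuousOn u (Icc 0 (cumMass m N)) ∧ ConcaveOn ℝ (Icc 0 (cumMass m N)) u ∧
    ∀ k ≤ N, potential m a b k ≤ u (cumMass m k)

/-- The least concave majorant, as the pointwise infimum of all concave majorants
(only its values on `[0, M_N]` matter). -/
noncomputable def leastConcaveMajorant {N : ℕ} (m a b : Fin N → ℝ) (s : ℝ) : ℝ :=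
  ⨅ u : {u : ℝ → ℝ // IsConcaveMajorant m a b u}, u.1 s

/-- The set `V` of boundary indices: those `k ∈ {0, …, N}` at which `(M_k, U_k)` lies on the least
concave majorant. -/
def boundarySet {N : ℕ} (m a b : Fin N → ℝ) : Set ℕ :=
  {k | k ≤ N ∧ potential m a b k = leastConcaveMajorant m a b (cumMass m k)}

/-- The number `ν` of clouds, where `V = {k_0 < k_1 < ⋯ < k_ν}`. -/
noncomputable def numClouds {N : ℕ} (m a b : Fin N → ℝ) : ℕ :=
  (boundarySet m a b).ncard - 1

/-- The boundary index `k_j`, for `0 ≤ j ≤ ν`: the `j`-th smallest element of `V`, counted from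
`j = 0`. -/
noncomputable def boundaryIndex {N : ℕ} (m a b : Fin N → ℝ) (j : ℕ) : ℕ :=
  Nat.nth (· ∈ boundarySet m a b) j

/-- The clouds, numbered `j = 0, …, ν - 1` from left to right: cloud `j` consists of the particles
between the boundary indices `k_j` and `k_{j+1}`. -/
def cloud {N : ℕ} (m a b : Fin N → ℝ) (j : ℕ) : Set (Fin N) :=
  {i | boundaryIndex m a b j ≤ i ∧ (i : ℕ) < boundaryIndex m a b (j + 1)}

/-- The slope of the least concave majorant over cloud `j`, for `j = 0, …, ν - 1`. -/
noncomputable def cloudSlope {N : ℕ} (m a b : Fin N → ℝ) (j : ℕ) : ℝ :=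
  (potential m a b (boundaryIndex m a b (j + 1)) - potential m a b (boundaryIndex m a b j)) /
    (cumMass m (boundaryIndex m a b (j + 1)) - cumMass m (boundaryIndex m a b j))

/-- Non-degeneracy: every cloud has some intrinsic activity. -/
def NonDegenerate {N : ℕ} (m a b : Fin N → ℝ) : Prop :=
  ∀ j < numClouds m a b, 0 < ∑ i : Fin N, open Classical in
    if i ∈ cloud m a b j then a i + b i else 0

/-- All clouds have the same slope. -/
def EqualSlopes {N : ℕ} (m a b : Fin N → ℝ) : Prop :=
  ∀ j < numClouds m a b, cloudSlope m a b j = cloudSlope m a b 0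

/-- The distance, in configuration `x`, between the leftmost particle of the rightmost cloud and
the rightmost particle of the leftmost cloud (both clouds are finite and non-empty). -/
noncomputable def extremeGap {N : ℕ} (m a b : Fin N → ℝ) (x : Config N) : ℤ :=
  sInf (x.1 '' cloud m a b (numClouds m a b - 1)) - sSup (x.1 '' cloud m a b 0)

/-- The number of `i ∈ {0, …, n}` such that the gap between the extreme clouds at the `i`-th jump
time of the path `X` is at most `r`. -/
noncomputable def smallGapCount {N : ℕ} (m a b : Fin N → ℝ) (X : ℝ≥0 → Config N) (n : ℕ)
    (r : ℝ) : ℕ :=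
  ∑ i ∈ Finset.range (n + 1), open Classical in
    if (extremeGap m a b (atJump X i) : ℝ) ≤ r then 1 else 0

end ElasticParticles

open ElasticParticles

/-! Let `v` be the common slope. The centred drifts `m i * (b i - a i + v)` have partial sums `v M_k
- U_k`, which are nonnegative, vanish exactly at the boundary indices and are positive inside each
cloud. Everything takes place on the jump chain, whose path probabilities are products of
`jumpProb`; exponential moments of multiplicative functionals are therefore iterates of the operator
`weightedStep`.

Two facts combine. (1) The extreme clouds stay tight. The moment of inertia of a cloud about its
centre of mass has drift at most a constant minus a positive multiple of the spread: summation by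
parts turns positive partial sums into attraction, and contact with outside particles only helps.
The root of one plus this moment has bounded increments and negative drift when large, so its
exponential moment grows at most linearly in time (`exists_exp_scatter_bound`,
`exists_spread_tail`). Up to time `n` both spreads are below `n^γ` except with probability of order
`n² exp(-ρ n^γ)`.

(2) The distance `Z` between the extreme centres of mass is seldom small. Contacts push the extreme
clouds apart, so `Z` is a submartingale, and its one-step second moment is bounded below. A convex
function of `Z`, quadratic up to `R` and linear beyond, thus gains a fixed amount at each visit to
`Z ≤ R - 1`. Subtracting a multiple of it from `√(n + Q)`, where `Q` is the moment of inertia of all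
particles, and scaling by `1/√n` gives a nonnegative `U` such that `exp U`, weighted by `exp (β / (R
√n))` per visit, grows by at most `exp (C / n)` per step (`exists_count_lyapunov`). Over `n` steps
the growth is bounded, and more than `t` visits have probability at most `D exp (-β t / (R √n))`
(`exists_count_tail`).

When both clouds are tight, a gap at most `n^γ` forces `Z ≤ 3 n^γ`. With `R = 3 n^γ + 1` and `t =
n^(1/2 + γ + 5ε)` the exponent in (2) is of order `n^(5ε)`, which beats `n^ε`; in (1) it suffices
that `ε < γ`. -/

namespace ElasticParticles

/-! ### Measurability of jump times and of the embedded chain. -/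

section Paths

variable {S : Type*} [TopologicalSpace S] [DiscreteTopology S] [MeasurableSpace S] [Countable S]
  [MeasurableSingletonClass S] {Ω : Type*} [MeasurableSpace Ω]

/-- A right-continuous process with values in a countable discrete space, evaluated at a random
time, is measurable. -/
theorem measurable_eval_of_right_continuous {X : ℝ≥0 → Ω → S} (hX : ∀ t, Measurable (X t))
    (hc : ∀ ω t, ContinuousWithinAt (fun s => X s ω) (Ici t) t) {σ : Ω → ℝ≥0}
    (hσ : Measurable σ) : Measurable fun ω => X (σ ω) ω := by
  refine measurable_to_countable' fun y => ?_
  -- Grid points strictly to the right of `σ`, with countably many values. They tend to `σ` from the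
  -- right, so `X` at them is eventually equal to `X` at `σ`.
  let s : ℕ → Ω → ℝ≥0 := fun k ω => ((⌊σ ω * (k + 1)⌋₊ : ℝ≥0) + 1) / (k + 1)
  have hs : ∀ k, Measurable fun ω => X (s k ω) ω := by
    intro k
    have h1 : Measurable fun p : ℕ × Ω => X (((p.1 : ℝ≥0) + 1) / (k + 1)) p.2 :=
      measurable_from_prod_countable_right fun j => hX (((j : ℝ≥0) + 1) / (k + 1))
    have h2 : Measurable fun ω => (⌊σ ω * ((k : ℝ≥0) + 1)⌋₊, ω) :=
      (Nat.measurable_floor.comp (hσ.mul_const _)).prodMk measurable_id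
    have h3 := h1.comp h2
    simp only [Function.comp_def] at h3
    simpa only [s] using h3
  have hlt : ∀ k ω, σ ω ≤ s k ω := by
    intro k ω
    have := (Nat.lt_floor_add_one (σ ω * ((k : ℝ≥0) + 1))).le
    exact (le_div_iff₀ (by positivity)).2 this
  have hle : ∀ k ω, s k ω ≤ σ ω + 1 / ((k : ℝ≥0) + 1) := by
    intro k ω
    have := Nat.floor_le (a := σ ω * ((k : ℝ≥0) + 1)) zero_le
    rw [show σ ω + 1 / ((k : ℝ≥0) + 1) = (σ ω * (k + 1) + 1) / (k + 1) by field_simp]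
    simp only [s]
    gcongr
  have hev : ∀ ω, ∀ᶠ k in atTop, X (s k ω) ω = X (σ ω) ω := by
    intro ω
    have h0 : Tendsto (fun k : ℕ => σ ω + 1 / ((k : ℝ≥0) + 1)) atTop (nhds (σ ω)) := by
      simpa using tendsto_const_nhds.add (tendsto_one_div_add_atTop_nhds_zero_nat (𝕜 := ℝ≥0))
    have h1 : Tendsto (fun k => s k ω) atTop (nhds (σ ω)) :=
      tendsto_of_tendsto_of_tendsto_of_le_of_le tendsto_const_nhds h0 (fun k => hlt k ω)
        (fun k => hle k ω)
    have h2 : Tendsto (fun k => s k ω) atTop (nhdsWithin (σ ω) (Ici (σ ω))) :=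
      tendsto_nhdsWithin_iff.2 ⟨h1, Eventually.of_forall fun k => hlt k ω⟩
    have h3 := (hc ω (σ ω)).tendsto.comp h2
    rw [nhds_discrete, tendsto_pure] at h3
    exact h3
  have : (fun ω => X (σ ω) ω) ⁻¹' {y} =
      ⋃ K : ℕ, ⋂ k : ℕ, ⋂ _ : K ≤ k, (fun ω => X (s k ω) ω) ⁻¹' {y} := by
    ext ω
    simp only [mem_preimage, mem_singleton_iff, mem_iUnion, mem_iInter]
    constructor
    · intro h
      obtain ⟨K, hK⟩ := eventually_atTop.1 (hev ω)
      exact ⟨K, fun k hk => (hK k hk).trans h⟩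
    · rintro ⟨K, hK⟩
      obtain ⟨K', hK'⟩ := eventually_atTop.1 (hev ω)
      rw [← hK' (max K K') (le_max_right _ _)]
      exact hK _ (le_max_left _ _)
  rw [this]
  exact MeasurableSet.iUnion fun K => MeasurableSet.iInter fun k => MeasurableSet.iInter fun _ =>
    hs k (measurableSet_singleton y)

theorem measurable_jumpTime {X : ℝ≥0 → Ω → S} (hX : ∀ t, Measurable (X t))
    (hc : ∀ ω t, ContinuousWithinAt (fun s => X s ω) (Ici t) t) (n : ℕ) :
    Measurable fun ω => jumpTime (X · ω) n := by
  induction n with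
  | zero => exact measurable_const
  | succ n ih =>
    have hY : Measurable fun ω => atJump (X · ω) n :=
      measurable_eval_of_right_continuous hX hc (ENNReal.measurable_toNNReal.comp ih)
    refine measurable_of_Iio fun s => ?_
    obtain ⟨D, hDc, hDd⟩ := TopologicalSpace.exists_countable_dense ℝ≥0
    -- By right continuity a state different from the `n`-th one persists for a while, so a time in
    -- the countable dense set `D` witnesses it.
    have : (fun ω => jumpTime (X · ω) (n + 1)) ⁻¹' Iio s =
        ⋃ q ∈ D, ({ω | jumpTime (X · ω) n ≤ q} ∩ {ω | (q : ℝ≥0∞) < s} ∩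
          {ω | X q ω = atJump (X · ω) n}ᶜ) := by
      ext ω
      simp only [mem_preimage, mem_Iio, jumpTime, iInf_lt_iff, mem_iUnion, mem_inter_iff,
        mem_ofPred_eq, mem_compl_iff, Subtype.exists, exists_prop]
      constructor
      · rintro ⟨t, ⟨h1, h2⟩, h3⟩
        have h4 : ∀ᶠ u in nhdsWithin t (Ici t), X u ω = X t ω := by
          have := (hc ω t).tendsto
          rwa [nhds_discrete, tendsto_pure] at this
        have h5 : ∀ᶠ u in nhdsWithin t (Ioi t), X u ω = X t ω :=
          h4.filter_mono (nhdsWithin_mono _ Ioi_subset_Ici_self)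
        have h6 : ∀ᶠ u : ℝ≥0 in nhdsWithin t (Ioi t), (u : ℝ≥0∞) < s := by
          refine Filter.Eventually.filter_mono nhdsWithin_le_nhds ?_
          exact (ENNReal.continuous_coe.tendsto t).eventually (gt_mem_nhds h3)
        obtain ⟨u, hu, hsub⟩ := mem_nhdsGT_iff_exists_Ioo_subset.1 (h5.and h6)
        obtain ⟨q, hqD, hq⟩ := hDd.exists_between hu
        have := hsub hq
        refine ⟨q, hqD, ⟨h1.trans (by exact_mod_cast hq.1.le), this.2⟩, ?_⟩
        rw [this.1]
        exact h2
      · rintro ⟨q, hqD, ⟨h1, h2⟩, h3⟩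
        exact ⟨q, ⟨h1, h3⟩, h2⟩
    rw [this]
    refine MeasurableSet.biUnion hDc fun q _ => ?_
    refine ((measurableSet_le ih measurable_const).inter (MeasurableSet.const _)).inter ?_
    exact (measurableSet_eq_fun (hX q) hY).compl

theorem measurable_atJump {X : ℝ≥0 → Ω → S} (hX : ∀ t, Measurable (X t))
    (hc : ∀ ω t, ContinuousWithinAt (fun s => X s ω) (Ici t) t) (n : ℕ) :
    Measurable fun ω => atJump (X · ω) n :=
  measurable_eval_of_right_continuous hX hc
    (ENNReal.measurable_toNNReal.comp (measurable_jumpTime hX hc n))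

end Paths

/-! ### Weighted path sums as iterated operators. -/

section Kernels

/-- One step of the operator `F ↦ w · κ F` for a kernel `κ` on a countable set. -/
noncomputable def weightedStep {S : Type*} (κ : S → S → ℝ≥0∞) (w F : S → ℝ≥0∞) (x : S) : ℝ≥0∞ :=
  w x * ∑' y, κ x y * F y

theorem weightedStep_mono {S : Type*} (κ : S → S → ℝ≥0∞) (w : S → ℝ≥0∞) {F G : S → ℝ≥0∞}
    (h : ∀ x, F x ≤ G x) (x : S) : weightedStep κ w F x ≤ weightedStep κ w G x := by
  unfold weightedStep
  gcongr with y
  exact h y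

/-- The weighted sum over all paths of length `n` from `x` is the `n`-th iterate of the weighted
step operator. -/
theorem tsum_paths_eq_iterate {S : Type*} [DecidableEq S] (κ : S → S → ℝ≥0∞)
    (w F : S → ℝ≥0∞) (n : ℕ) (x : S) :
    ∑' l : Fin (n + 1) → S, (if l 0 = x then 1 else 0) *
      (∏ k : Fin n, κ (l k.castSucc) (l k.succ)) * ((∏ k : Fin n, w (l k.castSucc)) *
        F (l (Fin.last n))) = (weightedStep κ w)^[n] F x := by
  induction n generalizing x with
  | zero =>
    rw [← (Equiv.funUnique (Fin 1) S).symm.tsum_eq]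
    simp only [Finset.univ_eq_empty, Finset.prod_empty, Function.iterate_zero, id]
    rw [tsum_eq_single x]
    · simp
    · intro y hy
      simp [hy]
  | succ n ih =>
    rw [Function.iterate_succ_apply', ← (Fin.consEquiv fun _ : Fin (n + 2) => S).tsum_eq,
      ENNReal.tsum_prod', tsum_eq_single x]
    · simp only [Fin.consEquiv_apply, Fin.cons_zero, Fin.prod_univ_succ, Fin.castSucc_zero,
        Fin.cons_succ, weightedStep]
      have h1 : ∀ z, (weightedStep κ w)^[n] F z = _ := fun z => (ih z).symm
      simp_rw [h1, ← ENNReal.tsum_mul_left]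
      rw [ENNReal.tsum_comm]
      refine tsum_congr fun l => ?_
      rw [tsum_eq_single (l 0)]
      · have h2 : Fin.cons (α := fun _ => S) x l (Fin.last (n + 1)) = l (Fin.last n) := by
          rw [← Fin.succ_last, Fin.cons_succ]
        simp only [← Fin.succ_castSucc, Fin.cons_succ, h2, if_true]
        ring
      · intro z hz
        simp [hz.symm]
    · intro y hy
      simp [Fin.consEquiv, hy]

end Kernels

/-! ### Transition kernel and one-step means of the jump chain. -/

section Kernel

variable {N : ℕ} {m a b : Fin N → ℝ}

/-- The expectation of `φ` after one step of the jump chain from `x`. -/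
noncomputable def jumpMean (m a b : Fin N → ℝ) (x : Config N) (φ : (Fin N → ℤ) → ℝ) : ℝ :=
  (∑ i, (leftRate m a x i * φ (x.1 - Pi.single i 1) +
    rightRate m b x i * φ (x.1 + Pi.single i 1))) / totalRate m a b x

/-- The transition probabilities of the jump chain. -/
noncomputable def jumpProb (m a b : Fin N → ℝ) (x y : Config N) : ℝ≥0∞ :=
  ENNReal.ofReal (jumpRate m a b x y / totalRate m a b x)

theorem leftRate_nonneg (hm : ∀ i, 0 < m i) (ha : ∀ i, 0 ≤ a i) (x : Config N) (i : Fin N) :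
    0 ≤ leftRate m a x i := by
  unfold leftRate
  split_ifs
  · refine Finset.sum_nonneg fun j _ => ?_
    split_ifs
    · exact div_nonneg (mul_nonneg (hm j).le (ha j)) (hm i).le
    · exact le_rfl
  · exact le_rfl

theorem rightRate_nonneg (hm : ∀ i, 0 < m i) (hb : ∀ i, 0 ≤ b i) (x : Config N) (i : Fin N) :
    0 ≤ rightRate m b x i := by
  unfold rightRate
  split_ifs
  · refine Finset.sum_nonneg fun j _ => ?_
    split_ifs
    · exact div_nonneg (mul_nonneg (hm j).le (hb j)) (hm i).le
    · exact le_rfl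
  · exact le_rfl

theorem totalRate_nonneg (hm : ∀ i, 0 < m i) (ha : ∀ i, 0 ≤ a i) (hb : ∀ i, 0 ≤ b i)
    (x : Config N) : 0 ≤ totalRate m a b x :=
  Finset.sum_nonneg fun i _ => add_nonneg (leftRate_nonneg hm ha x i) (rightRate_nonneg hm hb x i)

theorem monotone_of_succ_le {x : Fin N → ℤ}
    (h : ∀ i j : Fin N, (i : ℕ) + 1 = j → x i ≤ x j) : Monotone x := by
  cases N with
  | zero => exact fun i => i.elim0
  | succ n => exact Fin.monotone_iff_le_succ.2 fun i => h _ _ (by simp)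

theorem monotone_sub_single {x : Config N} {i : Fin N} (h : leftRate m a x i ≠ 0) :
    Monotone (x.1 - Pi.single i 1) := by
  have h' : ∀ j : Fin N, (j : ℕ) + 1 = i → x.1 j < x.1 i := by
    by_contra hc
    exact h (by unfold leftRate; rw [if_neg hc])
  refine monotone_of_succ_le fun k l hkl => ?_
  have h1 : x.1 k ≤ x.1 l := x.2 (Fin.le_def.2 (by omega))
  have hne : k ≠ l := fun h => by subst h; omega
  simp only [Pi.sub_apply, Pi.single_apply]
  split_ifs with h2 h3 h3
  · exact absurd (h2.trans h3.symm) hne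
  · omega
  · subst h3; have := h' k hkl; omega
  · omega

theorem monotone_add_single {x : Config N} {i : Fin N} (h : rightRate m b x i ≠ 0) :
    Monotone (x.1 + Pi.single i 1) := by
  have h' : ∀ j : Fin N, (j : ℕ) = i + 1 → x.1 i < x.1 j := by
    by_contra hc
    exact h (by unfold rightRate; rw [if_neg hc])
  refine monotone_of_succ_le fun k l hkl => ?_
  have h1 : x.1 k ≤ x.1 l := x.2 (Fin.le_def.2 (by omega))
  have hne : k ≠ l := fun h => by subst h; omega
  simp only [Pi.add_apply, Pi.single_apply]
  split_ifs with h2 h3 h3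
  · exact absurd (h2.trans h3.symm) hne
  · subst h2; have := h' l hkl.symm; omega
  · omega
  · omega

/-- `F` lives on all integer vectors because `x ± e_i` may leave the ordered configurations. Such a
move has rate zero, so it contributes to neither side. -/
theorem tsum_jumpProb_mul (hm : ∀ i, 0 < m i) (ha : ∀ i, 0 ≤ a i) (hb : ∀ i, 0 ≤ b i)
    (x : Config N) {F : (Fin N → ℤ) → ℝ} (hF : ∀ y, 0 ≤ F y) :
    ∑' y : Config N, jumpProb m a b x y * ENNReal.ofReal (F y.1) =
      ENNReal.ofReal (jumpMean m a b x F) := by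
  classical
  have hT := totalRate_nonneg hm ha hb x
  have hl := leftRate_nonneg hm ha x
  have hr := rightRate_nonneg hm hb x
  have key : ∀ y : Config N, jumpProb m a b x y * ENNReal.ofReal (F y.1) =
      ∑ i, (ENNReal.ofReal (if y.1 = x.1 - Pi.single i 1 then
          leftRate m a x i * F (x.1 - Pi.single i 1) / totalRate m a b x else 0) +
        ENNReal.ofReal (if y.1 = x.1 + Pi.single i 1 then
          rightRate m b x i * F (x.1 + Pi.single i 1) / totalRate m a b x else 0)) := by
    intro y
    have h1 : ∀ i, (0:ℝ) ≤ (if y.1 = x.1 - Pi.single i 1 then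
          leftRate m a x i * F (x.1 - Pi.single i 1) / totalRate m a b x else 0) := by
      intro i; split_ifs
      · exact div_nonneg (mul_nonneg (hl i) (hF _)) hT
      · exact le_rfl
    have h2 : ∀ i, (0:ℝ) ≤ (if y.1 = x.1 + Pi.single i 1 then
          rightRate m b x i * F (x.1 + Pi.single i 1) / totalRate m a b x else 0) := by
      intro i; split_ifs
      · exact div_nonneg (mul_nonneg (hr i) (hF _)) hT
      · exact le_rfl
    simp_rw [← ENNReal.ofReal_add (h1 _) (h2 _)]
    rw [← ENNReal.ofReal_sum_of_nonneg fun i _ => add_nonneg (h1 i) (h2 i), jumpProb,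
      ← ENNReal.ofReal_mul' (hF _)]
    congr 1
    rw [jumpRate, div_mul_eq_mul_div, Finset.sum_mul, Finset.sum_div]
    refine Finset.sum_congr rfl fun i _ => ?_
    rw [add_mul, add_div]
    congr 1
    · split_ifs with h
      · rw [h]
      · simp
    · split_ifs with h
      · rw [h]
      · simp
  have single : ∀ (z : Fin N → ℤ) (c : ℝ), (c ≠ 0 → Monotone z) →
      ∑' y : Config N, ENNReal.ofReal (if y.1 = z then c else 0) = ENNReal.ofReal c := by
    intro z c hz
    by_cases hc : c = 0
    · simp [hc]
    · rw [tsum_eq_single (⟨z, hz hc⟩ : Config N)]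
      · simp
      · intro y hy
        rw [if_neg fun h => hy (Subtype.ext h), ENNReal.ofReal_zero]
  simp_rw [key]
  rw [Summable.tsum_finsetSum fun _ _ => ENNReal.summable]
  simp_rw [ENNReal.tsum_add]
  rw [jumpMean, Finset.sum_div, ENNReal.ofReal_sum_of_nonneg]
  · refine Finset.sum_congr rfl fun i _ => ?_
    rw [single _ _ fun h => ?_, single _ _ fun h => ?_, add_div, ENNReal.ofReal_add]
    · exact div_nonneg (mul_nonneg (hl i) (hF _)) hT
    · exact div_nonneg (mul_nonneg (hr i) (hF _)) hT
    · exact monotone_add_single (b := b) (m := m) fun h0 => h (by rw [h0]; simp)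
    · exact monotone_sub_single (a := a) (m := m) fun h0 => h (by rw [h0]; simp)
  · exact fun i _ => div_nonneg (add_nonneg (mul_nonneg (hl i) (hF _)) (mul_nonneg (hr i) (hF _))) hT

theorem jumpMean_const {x : Config N} (hT : totalRate m a b x ≠ 0) (c : ℝ) :
    jumpMean m a b x (fun _ => c) = c := by
  rw [jumpMean, ← Finset.sum_congr rfl fun i _ => add_mul _ _ c, ← Finset.sum_mul]
  exact mul_div_cancel_left₀ c hT

theorem tsum_jumpProb (hm : ∀ i, 0 < m i) (ha : ∀ i, 0 ≤ a i) (hb : ∀ i, 0 ≤ b i)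
    {x : Config N} (hT : totalRate m a b x ≠ 0) : ∑' y : Config N, jumpProb m a b x y = 1 := by
  have := tsum_jumpProb_mul hm ha hb x (F := fun _ => 1) fun _ => zero_le_one
  simpa [jumpMean_const hT] using this

theorem weightedStep_le (hm : ∀ i, 0 < m i) (ha : ∀ i, 0 ≤ a i) (hb : ∀ i, 0 ≤ b i)
    {w F : (Fin N → ℤ) → ℝ} (hw : ∀ y, 0 ≤ w y) (hF : ∀ y, 0 ≤ F y) (x : Config N) {G : ℝ}
    (h : w x.1 * jumpMean m a b x F ≤ G) :
    weightedStep (jumpProb m a b) (fun y => ENNReal.ofReal (w y.1))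
      (fun y => ENNReal.ofReal (F y.1)) x ≤ ENNReal.ofReal G := by
  rw [weightedStep, tsum_jumpProb_mul hm ha hb x hF, ← ENNReal.ofReal_mul (hw _)]
  exact ENNReal.ofReal_le_ofReal h

end Kernel

/-! ### The events that the chain follows a given path. -/

section PathEvent

variable {N : ℕ} {Ω : Type*} {X : ℝ≥0 → Ω → Config N}

/-- The event that the jump chain follows the path `l`. -/
def pathEvent (X : ℝ≥0 → Ω → Config N) {n : ℕ} (l : Fin (n + 1) → Config N) : Set Ω :=
  {ω | atJump (X · ω) 0 = l 0 ∧ ∀ k : Fin n,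
    jumpTime (X · ω) k < jumpTime (X · ω) (k + 1) ∧ jumpTime (X · ω) (k + 1) < ∞ ∧
      atJump (X · ω) (k + 1) = l k.succ}

theorem atJump_of_mem_pathEvent {n : ℕ} {l : Fin (n + 1) → Config N} {ω : Ω}
    (h : ω ∈ pathEvent X l) (k : Fin (n + 1)) : atJump (X · ω) k = l k := by
  induction k using Fin.cases with
  | zero => exact h.1
  | succ k => exact (h.2 k).2.2

theorem pairwise_disjoint_pathEvent (X : ℝ≥0 → Ω → Config N) (n : ℕ) :
    Pairwise (Function.onFun Disjoint fun l : Fin (n + 1) → Config N => pathEvent X l) := by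
  intro l l' hne
  refine Set.disjoint_left.2 fun ω h h' => hne (funext fun k => ?_)
  rw [← atJump_of_mem_pathEvent h k, atJump_of_mem_pathEvent h' k]

end PathEvent

/-! ### From the law of the process to iterates of the kernel. -/

section Transfer

variable {N : ℕ} {m a b : Fin N → ℝ} {x₀ : Config N} {Ω : Type*} [MeasurableSpace Ω]
  {μ : Measure Ω} {X : ℝ≥0 → Ω → Config N}

theorem measurableSet_pathEvent (hX : IsElasticSystem m a b x₀ μ X) {n : ℕ}
    (l : Fin (n + 1) → Config N) : MeasurableSet (pathEvent X l) := by
  have h1 := measurable_jumpTime hX.measurable hX.right_continuous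
  have h2 := measurable_atJump hX.measurable hX.right_continuous
  have : pathEvent X l = {ω | atJump (X · ω) 0 = l 0} ∩ ⋂ k : Fin n,
      ({ω | jumpTime (X · ω) k < jumpTime (X · ω) (k + 1)} ∩
        ({ω | jumpTime (X · ω) (k + 1) < ∞} ∩ {ω | atJump (X · ω) (k + 1) = l k.succ})) := by
    ext ω
    simp [pathEvent]
  rw [this]
  refine (h2 0 (measurableSet_singleton _)).inter (MeasurableSet.iInter fun k => ?_)
  exact (measurableSet_lt (h1 _) (h1 _)).inter
    ((measurableSet_lt (h1 _) measurable_const).inter (h2 _ (measurableSet_singleton _)))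

theorem measure_pathEvent (hX : IsElasticSystem m a b x₀ μ X) {n : ℕ}
    (l : Fin (n + 1) → Config N) : μ (pathEvent X l) =
      (if l 0 = x₀ then 1 else 0) *
        ∏ k : Fin n, jumpProb m a b (l k.castSucc) (l k.succ) := by
  -- Holding-time thresholds `0` leave the law of the jump chain alone; `min k n` extends the finite
  -- path to all of `ℕ`.
  have h := hX.law n (fun k => l ⟨min k n, by omega⟩) (fun _ => 0)
  have hset : {ω | X 0 ω = l ⟨min 0 n, by omega⟩ ∧ ∀ k < n,
        jumpTime (X · ω) k + ((0 : ℝ≥0) : ℝ≥0∞) < jumpTime (X · ω) (k + 1) ∧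
        jumpTime (X · ω) (k + 1) < ∞ ∧
        atJump (X · ω) (k + 1) = l ⟨min (k + 1) n, by omega⟩} = pathEvent X l := by
    ext ω
    simp only [pathEvent, mem_ofPred_eq, ENNReal.coe_zero, add_zero]
    refine and_congr ?_ ?_
    · have : (⟨min 0 n, by omega⟩ : Fin (n + 1)) = 0 := by ext; simp
      rw [this]; simp [atJump, jumpTime]
    · refine ⟨fun h k => ?_, fun h k hk => ?_⟩
      · have := h k k.2
        have e : (⟨min (k + 1) n, by omega⟩ : Fin (n + 1)) = k.succ := by
          ext; simp
        rwa [e] at this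
      · have := h ⟨k, hk⟩
        have e : (⟨min (k + 1) n, by omega⟩ : Fin (n + 1)) = Fin.succ ⟨k, hk⟩ := by
          ext; simp; omega
        rw [e]; exact this
  rw [hset] at h
  rw [h, ← Fin.prod_univ_eq_prod_range (fun k => ENNReal.ofReal (jumpRate m a b
    (l ⟨min k n, by omega⟩) (l ⟨min (k + 1) n, by omega⟩) / totalRate m a b
    (l ⟨min k n, by omega⟩) * Real.exp (-(totalRate m a b (l ⟨min k n, by omega⟩) *
    ((0 : ℝ≥0) : ℝ)))))]
  have e0 : (⟨min 0 n, by omega⟩ : Fin (n + 1)) = 0 := by ext; simp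
  rw [e0]
  congr 1
  refine Finset.prod_congr rfl fun k _ => ?_
  have e1 : (⟨min k n, by omega⟩ : Fin (n + 1)) = k.castSucc := by
    ext; simp
  have e2 : (⟨min (k + 1) n, by omega⟩ : Fin (n + 1)) = k.succ := by
    ext; simp
  rw [e1, e2]
  simp [jumpProb]

/-- The measure is not assumed to be a probability; the law with no jumps forces it. -/
theorem measure_univ_of_isElasticSystem (hX : IsElasticSystem m a b x₀ μ X) : μ univ = 1 := by
  have h : (univ : Set Ω) = ⋃ y : Config N, X 0 ⁻¹' {y} := by ext; simp
  rw [h, measure_iUnion]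
  · have h2 : ∀ y, μ (X 0 ⁻¹' {y}) = if y = x₀ then 1 else 0 := by
      intro y
      have := hX.law 0 (fun _ => y) (fun _ => 0)
      simp only [Finset.range_zero, Finset.prod_empty, mul_one, not_lt_zero, IsEmpty.forall_iff,
        implies_true, and_true] at this
      exact this
    simp_rw [h2]
    exact tsum_ite_eq x₀ _
  · intro y y' hne
    refine Set.disjoint_left.2 fun ω h h' => hne ?_
    exact Eq.trans (Eq.symm h) h'
  · exact fun y => hX.measurable 0 (measurableSet_singleton y)

/-- As the total rate never vanishes, the rows of `jumpProb` sum to `1`, and so do the path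
probabilities. -/
theorem measure_compl_iUnion_pathEvent (hm : ∀ i, 0 < m i) (ha : ∀ i, 0 ≤ a i)
    (hb : ∀ i, 0 ≤ b i) (hT : ∀ x, totalRate m a b x ≠ 0) (hX : IsElasticSystem m a b x₀ μ X)
    (n : ℕ) : μ (⋃ l : Fin (n + 1) → Config N, pathEvent X l)ᶜ = 0 := by
  have hU := measure_univ_of_isElasticSystem hX
  have hmeas : MeasurableSet (⋃ l : Fin (n + 1) → Config N, pathEvent X l) :=
    MeasurableSet.iUnion fun l => measurableSet_pathEvent hX l
  have h1 : μ (⋃ l : Fin (n + 1) → Config N, pathEvent X l) = 1 := by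
    rw [measure_iUnion (pairwise_disjoint_pathEvent X n) fun l => measurableSet_pathEvent hX l]
    have h2 := tsum_paths_eq_iterate (jumpProb m a b) (fun _ => 1) (fun _ => 1) n x₀
    simp only [Finset.prod_const_one, mul_one] at h2
    simp_rw [measure_pathEvent hX]
    rw [h2]
    have h3 : weightedStep (jumpProb m a b) (fun _ => 1) (fun _ => 1) = fun _ => 1 := by
      funext x
      simp [weightedStep, tsum_jumpProb hm ha hb (hT x)]
    exact congrFun (Function.iterate_fixed h3 n) x₀
  rw [measure_compl hmeas (by rw [h1]; exact ENNReal.one_ne_top), hU, h1, tsub_self]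

/-- Chernoff-type bound: the probability of an event on which a multiplicative functional of the
jump chain is at least `1` is bounded by an iterate of the weighted step operator. -/
theorem measure_le_iterate_weightedStep (hm : ∀ i, 0 < m i) (ha : ∀ i, 0 ≤ a i)
    (hb : ∀ i, 0 ≤ b i) (hT : ∀ x, totalRate m a b x ≠ 0) (hX : IsElasticSystem m a b x₀ μ X)
    (n : ℕ) (w F : Config N → ℝ≥0∞) {B : Set Ω}
    (hB : ∀ ω ∈ B, 1 ≤ (∏ k ∈ Finset.range n, w (atJump (X · ω) k)) * F (atJump (X · ω) n)) :
    μ B ≤ (weightedStep (jumpProb m a b) w)^[n] F x₀ := by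
  have hsub : B ⊆ (⋃ l : Fin (n + 1) → Config N, B ∩ pathEvent X l) ∪
      (⋃ l : Fin (n + 1) → Config N, pathEvent X l)ᶜ := by
    intro ω hω
    by_cases h : ω ∈ ⋃ l : Fin (n + 1) → Config N, pathEvent X l
    · left
      obtain ⟨l, hl⟩ := mem_iUnion.1 h
      exact mem_iUnion.2 ⟨l, hω, hl⟩
    · exact Or.inr h
  calc μ B ≤ μ (⋃ l : Fin (n + 1) → Config N, B ∩ pathEvent X l) + 0 := by
        rw [← measure_compl_iUnion_pathEvent hm ha hb hT hX n]
        exact (measure_mono hsub).trans (measure_union_le _ _)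
    _ ≤ ∑' l : Fin (n + 1) → Config N, μ (B ∩ pathEvent X l) := by
        rw [add_zero]; exact measure_iUnion_le _
    _ ≤ _ := by
        rw [← tsum_paths_eq_iterate]
        refine ENNReal.tsum_le_tsum fun l => ?_
        -- The functional depends on the path only, so one point of `B` on the path shows that its
        -- value there is at least `1`.
        rcases (B ∩ pathEvent X l).eq_empty_or_nonempty with h | ⟨ω, hω, hl⟩
        · rw [h, measure_empty]; exact zero_le
        · refine (measure_mono inter_subset_right).trans ?_
          rw [measure_pathEvent hX]
          refine le_mul_of_one_le_right zero_le ?_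
          have h := hB ω hω
          rw [← Fin.prod_univ_eq_prod_range (fun k => w (atJump (X · ω) k)),
            show atJump (X · ω) n = l (Fin.last n) from
              atJump_of_mem_pathEvent hl (Fin.last n)] at h
          have h4 : ∀ k : Fin n, atJump (X · ω) k = l k.castSucc := fun k =>
            atJump_of_mem_pathEvent hl k.castSucc
          simp_rw [h4] at h
          exact h

end Transfer

/-! ### Stacks, and the redistribution of intrinsic jumps. -/

section Stacks

variable {N : ℕ} {m a b : Fin N → ℝ}

/-- The particle with the largest label in the stack of particle `j`. -/
def stackTop (x : Fin N → ℤ) (j : Fin N) : Fin N :=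
  (Finset.univ.filter fun i => x i = x j).max' ⟨j, by simp⟩

/-- The particle with the smallest label in the stack of particle `j`. -/
def stackBot (x : Fin N → ℤ) (j : Fin N) : Fin N :=
  (Finset.univ.filter fun i => x i = x j).min' ⟨j, by simp⟩

theorem apply_stackTop (x : Fin N → ℤ) (j : Fin N) : x (stackTop x j) = x j :=
  (Finset.mem_filter.1 (Finset.max'_mem (Finset.univ.filter fun i => x i = x j)
    ⟨j, by simp⟩)).2

theorem apply_stackBot (x : Fin N → ℤ) (j : Fin N) : x (stackBot x j) = x j :=
  (Finset.mem_filter.1 (Finset.min'_mem (Finset.univ.filter fun i => x i = x j)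
    ⟨j, by simp⟩)).2

theorem le_stackTop {x : Fin N → ℤ} {i j : Fin N} (h : x i = x j) : i ≤ stackTop x j :=
  Finset.le_max' _ _ (by simpa using h)

theorem stackBot_le {x : Fin N → ℤ} {i j : Fin N} (h : x i = x j) : stackBot x j ≤ i :=
  Finset.min'_le _ _ (by simpa using h)

/-- The right side is the condition under which `j` contributes to `rightRate m b x i`. By
monotonicity, looking at the next label is enough to see that a stack ends. -/
theorem stackTop_eq_iff (x : Config N) (i j : Fin N) : stackTop x.1 j = i ↔
    (∀ k : Fin N, (k : ℕ) = i + 1 → x.1 i < x.1 k) ∧ j ≤ i ∧ x.1 j = x.1 i := by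
  constructor
  · rintro rfl
    refine ⟨fun k hk => ?_, le_stackTop rfl, (apply_stackTop _ _).symm⟩
    refine lt_of_le_of_ne (x.2 (Fin.le_def.2 (by omega))) fun h => ?_
    have := le_stackTop (h.symm.trans (apply_stackTop x.1 j))
    rw [Fin.le_def] at this
    omega
  · rintro ⟨h1, h2, h3⟩
    refine le_antisymm ?_ (le_stackTop h3.symm)
    by_contra hlt
    rw [not_le, Fin.lt_def] at hlt
    have h4 := h1 ⟨i + 1, by omega⟩ rfl
    have h5 : x.1 ⟨i + 1, by omega⟩ ≤ x.1 (stackTop x.1 j) := x.2 (Fin.le_def.2 (by simpa using hlt))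
    rw [apply_stackTop x.1 j, h3] at h5
    omega

theorem stackBot_eq_iff (x : Config N) (i j : Fin N) : stackBot x.1 j = i ↔
    (∀ k : Fin N, (k : ℕ) + 1 = i → x.1 k < x.1 i) ∧ i ≤ j ∧ x.1 j = x.1 i := by
  constructor
  · rintro rfl
    refine ⟨fun k hk => ?_, stackBot_le rfl, (apply_stackBot _ _).symm⟩
    refine lt_of_le_of_ne (x.2 (Fin.le_def.2 (by omega))) fun h => ?_
    have := stackBot_le (h.trans (apply_stackBot x.1 j))
    rw [Fin.le_def] at this
    omega
  · rintro ⟨h1, h2, h3⟩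
    refine le_antisymm (stackBot_le h3.symm) ?_
    by_contra hlt
    rw [not_le, Fin.lt_def] at hlt
    have h4 := h1 ⟨i - 1, by omega⟩ (by simp only; omega)
    have h5 : x.1 (stackBot x.1 j) ≤ x.1 ⟨i - 1, by omega⟩ := x.2 (Fin.le_def.2 (by simp only; omega))
    rw [apply_stackBot x.1 j, h3] at h5
    omega

/-- The right jumps of the top particle of a stack are the intrinsic right jumps of its members. -/
theorem sum_rightRate_mul (x : Config N) (φ : Fin N → ℝ) :
    ∑ i, rightRate m b x i * φ i =
      ∑ j, m j * b j / m (stackTop x.1 j) * φ (stackTop x.1 j) := by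
  classical
  have h : ∀ i, rightRate m b x i * φ i =
      ∑ j, if stackTop x.1 j = i then m j * b j / m i * φ i else 0 := by
    intro i
    unfold rightRate
    split_ifs with hi
    · rw [Finset.sum_mul]
      refine Finset.sum_congr rfl fun j _ => ?_
      simp only [stackTop_eq_iff, ite_mul, zero_mul]
      split_ifs <;> first | rfl | (exfalso; simp_all)
    · rw [zero_mul, Finset.sum_eq_zero]
      intro j _
      rw [if_neg fun h => hi ((stackTop_eq_iff x i j).1 h).1]
  simp_rw [h]
  rw [Finset.sum_comm]
  simp

/-- The left jumps of the bottom particle of a stack are the intrinsic left jumps of its members. -/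
theorem sum_leftRate_mul (x : Config N) (φ : Fin N → ℝ) :
    ∑ i, leftRate m a x i * φ i =
      ∑ j, m j * a j / m (stackBot x.1 j) * φ (stackBot x.1 j) := by
  classical
  have h : ∀ i, leftRate m a x i * φ i =
      ∑ j, if stackBot x.1 j = i then m j * a j / m i * φ i else 0 := by
    intro i
    unfold leftRate
    split_ifs with hi
    · rw [Finset.sum_mul]
      refine Finset.sum_congr rfl fun j _ => ?_
      simp only [stackBot_eq_iff, ite_mul, zero_mul]
      split_ifs <;> first | rfl | (exfalso; simp_all)
    · rw [zero_mul, Finset.sum_eq_zero]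
      intro j _
      rw [if_neg fun h => hi ((stackBot_eq_iff x i j).1 h).1]
  simp_rw [h]
  rw [Finset.sum_comm]
  simp

theorem totalRate_eq (x : Config N) : totalRate m a b x =
    ∑ j, (m j * a j / m (stackBot x.1 j) + m j * b j / m (stackTop x.1 j)) := by
  have h1 := sum_rightRate_mul (m := m) (b := b) x fun _ => 1
  have h2 := sum_leftRate_mul (m := m) (a := a) x fun _ => 1
  simp only [mul_one] at h1 h2
  rw [totalRate, Finset.sum_add_distrib, Finset.sum_add_distrib, h1, h2]

theorem totalRate_pos (hm : ∀ i, 0 < m i) (ha : ∀ i, 0 ≤ a i) (hb : ∀ i, 0 ≤ b i)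
    (h : ∃ j, 0 < a j + b j) (x : Config N) : 0 < totalRate m a b x := by
  obtain ⟨j, hj⟩ := h
  rw [totalRate_eq]
  have h1 : ∀ i, 0 ≤ m i * a i / m (stackBot x.1 i) := fun i =>
    div_nonneg (mul_nonneg (hm i).le (ha i)) (hm _).le
  have h2 : ∀ i, 0 ≤ m i * b i / m (stackTop x.1 i) := fun i =>
    div_nonneg (mul_nonneg (hm i).le (hb i)) (hm _).le
  refine Finset.sum_pos' (fun i _ => add_nonneg (h1 i) (h2 i)) ⟨j, Finset.mem_univ _, ?_⟩
  rcases (ha j).eq_or_lt with h0 | h0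
  · have : 0 < b j := by linarith
    exact add_pos_of_nonneg_of_pos (h1 j) (div_pos (mul_pos (hm j) this) (hm _))
  · exact add_pos_of_pos_of_nonneg (div_pos (mul_pos (hm j) h0) (hm _)) (h2 j)

theorem exists_totalRate_le (hm : ∀ i, 0 < m i) (ha : ∀ i, 0 ≤ a i) (hb : ∀ i, 0 ≤ b i) :
    ∃ Λ : ℝ, 0 < Λ ∧ ∀ x : Config N, totalRate m a b x ≤ Λ := by
  refine ⟨1 + ∑ j, ∑ k, (m j * a j / m k + m j * b j / m k), ?_, fun x => ?_⟩
  · have : 0 ≤ ∑ j, ∑ k, (m j * a j / m k + m j * b j / m k) :=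
      Finset.sum_nonneg fun j _ => Finset.sum_nonneg fun k _ => add_nonneg
        (div_nonneg (mul_nonneg (hm j).le (ha j)) (hm _).le)
        (div_nonneg (mul_nonneg (hm j).le (hb j)) (hm _).le)
    linarith
  · rw [totalRate_eq]
    refine le_trans (Finset.sum_le_sum fun j _ => ?_) (le_add_of_nonneg_left zero_le_one)
    rw [Finset.sum_add_distrib]
    exact add_le_add
      (Finset.single_le_sum (f := fun k => m j * a j / m k) (fun k _ =>
        div_nonneg (mul_nonneg (hm j).le (ha j)) (hm k).le) (Finset.mem_univ _))
      (Finset.single_le_sum (f := fun k => m j * b j / m k) (fun k _ =>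
        div_nonneg (mul_nonneg (hm j).le (hb j)) (hm k).le) (Finset.mem_univ _))

end Stacks

/-! ### One-step drift and exponential moments. -/

section JumpMean

variable {N : ℕ} {m a b : Fin N → ℝ} {x : Config N}

theorem jumpMean_add (φ ψ : (Fin N → ℤ) → ℝ) :
    jumpMean m a b x (fun y => φ y + ψ y) = jumpMean m a b x φ + jumpMean m a b x ψ := by
  simp only [jumpMean, ← add_div, ← Finset.sum_add_distrib]
  congr 1
  exact Finset.sum_congr rfl fun i _ => by ring

theorem jumpMean_const_mul (c : ℝ) (φ : (Fin N → ℤ) → ℝ) :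
    jumpMean m a b x (fun y => c * φ y) = c * jumpMean m a b x φ := by
  simp only [jumpMean, ← mul_div_assoc, Finset.mul_sum]
  congr 1
  exact Finset.sum_congr rfl fun i _ => by ring

theorem jumpMean_mono (hm : ∀ i, 0 < m i) (ha : ∀ i, 0 ≤ a i) (hb : ∀ i, 0 ≤ b i)
    {φ ψ : (Fin N → ℤ) → ℝ} (hl : ∀ i, φ (x.1 - Pi.single i 1) ≤ ψ (x.1 - Pi.single i 1))
    (hr : ∀ i, φ (x.1 + Pi.single i 1) ≤ ψ (x.1 + Pi.single i 1)) :
    jumpMean m a b x φ ≤ jumpMean m a b x ψ := by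
  refine div_le_div_of_nonneg_right (Finset.sum_le_sum fun i _ => ?_) (totalRate_nonneg hm ha hb x)
  exact add_le_add (mul_le_mul_of_nonneg_left (hl i) (leftRate_nonneg hm ha x i))
    (mul_le_mul_of_nonneg_left (hr i) (rightRate_nonneg hm hb x i))

/-- Second-order bound for exponential moments of a function with bounded increments. -/
theorem jumpMean_exp_le (hm : ∀ i, 0 < m i) (ha : ∀ i, 0 ≤ a i) (hb : ∀ i, 0 ≤ b i)
    (hT : totalRate m a b x ≠ 0) {f : (Fin N → ℤ) → ℝ} {K : ℝ} (hK : K ≤ 1)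
    (hl : ∀ i, |f (x.1 - Pi.single i 1) - f x.1| ≤ K)
    (hr : ∀ i, |f (x.1 + Pi.single i 1) - f x.1| ≤ K) :
    jumpMean m a b x (fun y => Real.exp (f y)) ≤
      Real.exp (f x.1) * (1 + (jumpMean m a b x f - f x.1) + K ^ 2) := by
  -- This is `e^z ≤ 1 + z + z²` for `|z| ≤ 1`, in a form affine in `f y`, which the mean respects.
  have key : ∀ y, |f y - f x.1| ≤ K →
      Real.exp (f y) ≤ Real.exp (f x.1) * f y + Real.exp (f x.1) * (1 - f x.1 + K ^ 2) := by
    intro y hy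
    have h1 := Real.abs_exp_sub_one_sub_id_le (hy.trans hK)
    have h2 : (f y - f x.1) ^ 2 ≤ K ^ 2 := sq_le_sq' (abs_le.1 hy).1 (abs_le.1 hy).2
    have h3 := (abs_le.1 h1).2
    have h4 : Real.exp (f y) = Real.exp (f x.1) * Real.exp (f y - f x.1) := by
      rw [← Real.exp_add]; ring_nf
    rw [h4, ← mul_add]
    exact mul_le_mul_of_nonneg_left (by linarith) (Real.exp_pos _).le
  refine (jumpMean_mono hm ha hb (ψ := fun y => Real.exp (f x.1) * f y +
    Real.exp (f x.1) * (1 - f x.1 + K ^ 2)) (fun i => key _ (hl i)) fun i => key _ (hr i)).trans_eq ?_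
  rw [jumpMean_add, jumpMean_const_mul, jumpMean_const hT]
  ring

theorem sqrt_add_sub_sqrt_le {c u u' : ℝ} (hc : 0 < c) (hu : 0 ≤ u) (hu' : 0 ≤ u') :
    Real.sqrt (c + u') - Real.sqrt (c + u) ≤ (u' - u) / (2 * Real.sqrt (c + u)) := by
  have h : 0 < Real.sqrt (c + u) := Real.sqrt_pos.2 (by linarith)
  rw [le_div_iff₀ (by positivity)]
  have h1 := Real.sq_sqrt (show 0 ≤ c + u by linarith)
  have h2 := Real.sq_sqrt (show 0 ≤ c + u' by linarith)
  nlinarith [sq_nonneg (Real.sqrt (c + u') - Real.sqrt (c + u))]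

/-- The concave root lies below its tangent at the current value, so there is no second-order term.
-/
theorem jumpMean_sqrt_sub_le (hm : ∀ i, 0 < m i) (ha : ∀ i, 0 ≤ a i) (hb : ∀ i, 0 ≤ b i)
    (hT : totalRate m a b x ≠ 0) {q : (Fin N → ℤ) → ℝ} (hq : ∀ y, 0 ≤ q y) {c : ℝ} (hc : 0 < c) :
    jumpMean m a b x (fun y => Real.sqrt (c + q y)) - Real.sqrt (c + q x.1) ≤
      (jumpMean m a b x q - q x.1) / (2 * Real.sqrt (c + q x.1)) := by
  have key : ∀ y, Real.sqrt (c + q y) ≤ (2 * Real.sqrt (c + q x.1))⁻¹ * q y +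
      (Real.sqrt (c + q x.1) - q x.1 / (2 * Real.sqrt (c + q x.1))) := by
    intro y
    have := sqrt_add_sub_sqrt_le hc (hq x.1) (hq y)
    rw [sub_div, div_eq_inv_mul] at this
    linarith
  have := jumpMean_mono (m := m) (a := a) (b := b) (x := x) hm ha hb
    (φ := fun y => Real.sqrt (c + q y)) (ψ := fun y => (2 * Real.sqrt (c + q x.1))⁻¹ * q y +
      (Real.sqrt (c + q x.1) - q x.1 / (2 * Real.sqrt (c + q x.1))))
    (fun i => key (x.1 - Pi.single i 1)) fun i => key (x.1 + Pi.single i 1)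
  rw [jumpMean_add, jumpMean_const_mul, jumpMean_const hT] at this
  rw [sub_div, div_eq_inv_mul]
  linarith

/-- A positive function with bounded increments and negative drift off a bounded set has an
exponential moment that grows by at most a constant in each step. -/
theorem exists_exp_drift_bound (hm : ∀ i, 0 < m i) (ha : ∀ i, 0 ≤ a i) (hb : ∀ i, 0 ≤ b i)
    (hT : ∀ x, totalRate m a b x ≠ 0) {f : (Fin N → ℤ) → ℝ} {K η B : ℝ} (hK : 0 < K) (hη : 0 < η)
    (hB : 0 ≤ B) (hf : ∀ y, 1 ≤ f y)
    (hl : ∀ (x : Config N) i, |f (x.1 - Pi.single i 1) - f x.1| ≤ K)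
    (hr : ∀ (x : Config N) i, |f (x.1 + Pi.single i 1) - f x.1| ≤ K)
    (hd : ∀ x : Config N, jumpMean m a b x f - f x.1 ≤ -η + B / f x.1) :
    ∃ θ C : ℝ, 0 < θ ∧ 0 ≤ C ∧ ∀ x : Config N,
      jumpMean m a b x (fun y => Real.exp (θ * f y)) ≤ Real.exp (θ * f x.1) + C := by
  -- The first bound keeps the increments of `θ f` below `1`; the second makes the quadratic term at
  -- most half of the drift `θ η`.
  set θ := min K⁻¹ (η / (2 * K ^ 2)) with hθ
  have hθ0 : 0 < θ := lt_min (inv_pos.2 hK) (by positivity)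
  have hθK : θ * K ≤ 1 := by
    have := mul_le_mul_of_nonneg_right (min_le_left K⁻¹ (η / (2 * K ^ 2))) hK.le
    rwa [inv_mul_cancel₀ hK.ne'] at this
  have hθη : θ * K ^ 2 ≤ η / 2 := by
    have := mul_le_mul_of_nonneg_right (min_le_right K⁻¹ (η / (2 * K ^ 2))) (sq_nonneg K)
    refine this.trans_eq ?_
    field_simp
  refine ⟨θ, Real.exp (θ * (2 * B / η)) * (2 + θ * B), hθ0, by positivity, fun x => ?_⟩
  have h1 := jumpMean_exp_le (m := m) (a := a) (b := b) (x := x) hm ha hb (hT x)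
    (f := fun y => θ * f y) hθK
    (fun i => by rw [← mul_sub, abs_mul, abs_of_pos hθ0]; exact mul_le_mul_of_nonneg_left (hl x i) hθ0.le)
    (fun i => by rw [← mul_sub, abs_mul, abs_of_pos hθ0]; exact mul_le_mul_of_nonneg_left (hr x i) hθ0.le)
  refine h1.trans ?_
  rw [jumpMean_const_mul, ← mul_sub]
  have hfx := hf x.1
  have hd' := mul_le_mul_of_nonneg_left (hd x) hθ0.le
  -- Above `2B/η` the drift is at most `-η/2`, which absorbs the quadratic term. Below it all is
  -- bounded, which gives the constant `C`.
  rcases le_or_gt (2 * B / η) (f x.1) with h | h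
  · have h2 : B / f x.1 ≤ η / 2 := by
      rw [div_le_iff₀ hη] at h
      rw [div_le_iff₀ (by linarith)]
      linarith
    have h3 : θ * (-η + B / f x.1) ≤ θ * (-(η / 2)) := mul_le_mul_of_nonneg_left (by linarith) hθ0.le
    have h4 : (θ * K) ^ 2 ≤ θ * (η / 2) := by nlinarith
    have h5 : Real.exp (θ * f x.1) * (1 + θ * (jumpMean m a b x f - f x.1) + (θ * K) ^ 2) ≤
        Real.exp (θ * f x.1) * 1 := mul_le_mul_of_nonneg_left (by linarith) (Real.exp_pos _).le
    have : 0 ≤ Real.exp (θ * (2 * B / η)) * (2 + θ * B) := by positivity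
    linarith
  · have h2 : B / f x.1 ≤ B := div_le_self hB hfx
    have h3 : θ * (-η + B / f x.1) ≤ θ * B := mul_le_mul_of_nonneg_left (by linarith) hθ0.le
    have h4 : (θ * K) ^ 2 ≤ 1 := by
      have : 0 ≤ θ * K := by positivity
      nlinarith
    have h5 : Real.exp (θ * f x.1) * (1 + θ * (jumpMean m a b x f - f x.1) + (θ * K) ^ 2) ≤
        Real.exp (θ * f x.1) * (2 + θ * B) :=
      mul_le_mul_of_nonneg_left (by linarith) (Real.exp_pos _).le
    have h6 : Real.exp (θ * f x.1) * (2 + θ * B) ≤ Real.exp (θ * (2 * B / η)) * (2 + θ * B) := by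
      gcongr
    have := Real.exp_pos (θ * f x.1)
    linarith

end JumpMean

/-! ### Blocks of consecutive labels and summation by parts. -/

section Block

variable {N : ℕ}

/-- The particles with labels in `[p, q)`. -/
def block (N p q : ℕ) : Finset (Fin N) := Finset.univ.filter fun i => p ≤ (i : ℕ) ∧ (i : ℕ) < q

theorem mem_block {p q : ℕ} {i : Fin N} : i ∈ block N p q ↔ p ≤ (i : ℕ) ∧ (i : ℕ) < q := by
  simp [block]

theorem sum_block_succ {p q : ℕ} (hpq : p ≤ q) (hq : q < N) (f : Fin N → ℝ) :
    ∑ i ∈ block N p (q + 1), f i = ∑ i ∈ block N p q, f i + f ⟨q, hq⟩ := by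
  classical
  have : block N p (q + 1) = insert ⟨q, hq⟩ (block N p q) := by
    ext i
    simp only [Finset.mem_insert, mem_block, Fin.ext_iff]
    omega
  rw [this, Finset.sum_insert (by simp [mem_block]), add_comm]

/-- Summation by parts on a block, for a monotone sequence. -/
theorem sum_mul_block_le {w y : Fin N → ℝ} (hy : Monotone y) {δ : ℝ} {p q : ℕ} (hpq : p < q)
    (hq : q ≤ N) (hw : ∀ k, p < k → k < q → δ ≤ ∑ i ∈ block N p k, w i) :
    ∑ i ∈ block N p q, w i * y i ≤ (∑ i ∈ block N p q, w i) * y ⟨q - 1, by omega⟩ -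
      δ * (y ⟨q - 1, by omega⟩ - y ⟨p, by omega⟩) := by
  induction q, hpq using Nat.le_induction with
  | base =>
    rw [sum_block_succ le_rfl hq, sum_block_succ le_rfl hq]
    have : block N p p = ∅ := by ext i; simp [mem_block]
    simp [this]
  | succ q hpq ih =>
    have h1 := ih (by omega) fun k hk hkq => hw k hk (by omega)
    have h2 := hw q hpq (by omega)
    have h3 : y ⟨q - 1, by omega⟩ ≤ y ⟨q, hq⟩ := hy (Fin.le_def.2 (by simp))
    rw [sum_block_succ (by omega) hq, sum_block_succ (by omega) hq]
    simp only [Nat.add_sub_cancel]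
    nlinarith [mul_le_mul_of_nonneg_right h2 (sub_nonneg.2 h3)]

end Block

/-! ### Centre of mass and moment of inertia under a single jump. -/

section Centroid

variable {N : ℕ} (m : Fin N → ℝ) (C : Finset (Fin N))

/-- The centre of mass of the particles in `C`. -/
noncomputable def centroid (x : Fin N → ℤ) : ℝ := (∑ i ∈ C, m i * x i) / ∑ i ∈ C, m i

/-- The moment of inertia of the particles in `C` about their centre of mass. -/
noncomputable def scatter (x : Fin N → ℤ) : ℝ := ∑ i ∈ C, m i * ((x i : ℝ) - centroid m C x) ^ 2

variable {m C}

theorem scatter_nonneg (hm : ∀ i, 0 < m i) (x : Fin N → ℤ) : 0 ≤ scatter m C x :=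
  Finset.sum_nonneg fun i _ => mul_nonneg (hm i).le (sq_nonneg _)

theorem sum_mass_pos (hm : ∀ i, 0 < m i) (hC : C.Nonempty) : 0 < ∑ i ∈ C, m i :=
  Finset.sum_pos (fun i _ => hm i) hC

theorem sum_mul_eq_centroid (hm : ∀ i, 0 < m i) (hC : C.Nonempty) (x : Fin N → ℤ) :
    ∑ i ∈ C, m i * x i = (∑ i ∈ C, m i) * centroid m C x := by
  rw [centroid, mul_div_cancel₀ _ (sum_mass_pos hm hC).ne']

theorem sum_mul_sub_centroid (hm : ∀ i, 0 < m i) (hC : C.Nonempty) (x : Fin N → ℤ) :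
    ∑ i ∈ C, m i * ((x i : ℝ) - centroid m C x) = 0 := by
  simp_rw [mul_sub]
  rw [Finset.sum_sub_distrib, sum_mul_eq_centroid hm hC, ← Finset.sum_mul, sub_self]

theorem scatter_eq (hm : ∀ i, 0 < m i) (hC : C.Nonempty) (x : Fin N → ℤ) :
    scatter m C x = ∑ i ∈ C, m i * (x i : ℝ) ^ 2 - (∑ i ∈ C, m i) * centroid m C x ^ 2 := by
  have h : ∀ i, m i * ((x i : ℝ) - centroid m C x) ^ 2 = m i * (x i : ℝ) ^ 2 -
      2 * centroid m C x * (m i * x i) + m i * centroid m C x ^ 2 := fun i => by ring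
  rw [scatter, Finset.sum_congr rfl fun i _ => h i, Finset.sum_add_distrib,
    Finset.sum_sub_distrib, ← Finset.mul_sum, ← Finset.sum_mul, sum_mul_eq_centroid hm hC]
  ring

theorem le_centroid (hm : ∀ i, 0 < m i) (hC : C.Nonempty) {x : Fin N → ℤ} {c : ℝ}
    (h : ∀ i ∈ C, c ≤ x i) : c ≤ centroid m C x := by
  rw [centroid, le_div_iff₀ (sum_mass_pos hm hC), Finset.mul_sum]
  exact Finset.sum_le_sum fun i hi => by
    rw [mul_comm]; exact mul_le_mul_of_nonneg_left (h i hi) (hm i).le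

theorem centroid_le (hm : ∀ i, 0 < m i) (hC : C.Nonempty) {x : Fin N → ℤ} {c : ℝ}
    (h : ∀ i ∈ C, (x i : ℝ) ≤ c) : centroid m C x ≤ c := by
  rw [centroid, div_le_iff₀ (sum_mass_pos hm hC), Finset.mul_sum]
  exact Finset.sum_le_sum fun i hi => by
    rw [mul_comm c]; exact mul_le_mul_of_nonneg_left (h i hi) (hm i).le

theorem sum_mul_add_single (x : Fin N → ℤ) (i : Fin N) (s : ℤ) (f : Fin N → ℤ → ℝ) :
    ∑ j ∈ C, f j ((x + Pi.single i s : Fin N → ℤ) j) =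
      ∑ j ∈ C, f j (x j) + if i ∈ C then f i (x i + s) - f i (x i) else 0 := by
  classical
  rw [← sub_eq_iff_eq_add', ← Finset.sum_sub_distrib]
  split_ifs with h
  · rw [Finset.sum_eq_single_of_mem i h]
    · simp
    · intro j _ hj
      simp [hj]
  · refine Finset.sum_eq_zero fun j hj => ?_
    have : j ≠ i := fun e => h (e ▸ hj)
    simp [this]

theorem centroid_add_single (x : Fin N → ℤ) (i : Fin N) (s : ℤ) :
    centroid m C (x + Pi.single i s) =
      centroid m C x + if i ∈ C then s * (m i / ∑ j ∈ C, m j) else 0 := by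
  rw [centroid, sum_mul_add_single x i s fun j z => m j * (z : ℝ), add_div, centroid]
  congr 1
  split_ifs
  · push_cast; ring
  · simp

theorem scatter_add_single (hm : ∀ i, 0 < m i) (x : Fin N → ℤ) (i : Fin N) {s : ℤ}
    (hs : s ^ 2 = 1) : scatter m C (x + Pi.single i s) = scatter m C x +
      if i ∈ C then 2 * s * (m i * ((x i : ℝ) - centroid m C x)) + (m i - m i ^ 2 / ∑ j ∈ C, m j)
      else 0 := by
  rcases C.eq_empty_or_nonempty with rfl | hC
  · simp [scatter]
  have hM := (sum_mass_pos hm hC).ne'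
  have hs' : (s : ℝ) ^ 2 = 1 := by exact_mod_cast hs
  rw [scatter_eq hm hC, scatter_eq hm hC, sum_mul_add_single x i s fun j z => m j * (z : ℝ) ^ 2,
    centroid_add_single]
  split_ifs
  · push_cast
    field_simp
    ring_nf
    rw [hs']
    ring
  · simp

theorem mul_sq_le_scatter (hm : ∀ i, 0 < m i) (x : Fin N → ℤ) {i : Fin N} (hi : i ∈ C) :
    m i * ((x i : ℝ) - centroid m C x) ^ 2 ≤ scatter m C x :=
  Finset.single_le_sum (f := fun i => m i * ((x i : ℝ) - centroid m C x) ^ 2)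
    (fun j _ => mul_nonneg (hm j).le (sq_nonneg _)) hi

/-- The first-order change `2 m_i |x_i - W|` of the moment is at most `2 K` times its root, because
`m_i (x_i - W)²` is one of its terms; hence the new value is at most `(u + K)²`. -/
theorem sqrt_scatter_add_single_le (hm : ∀ i, 0 < m i) (x : Fin N → ℤ) (i : Fin N) {s : ℤ}
    (hs : s ^ 2 = 1) {c K : ℝ} (hc : 0 ≤ c) (hK : 0 ≤ K) (hmK : ∀ i, m i ≤ K ^ 2) :
    Real.sqrt (c + scatter m C (x + Pi.single i s)) ≤ Real.sqrt (c + scatter m C x) + K := by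
  have h0 := scatter_nonneg (C := C) hm x
  refine Real.sqrt_le_iff.2 ⟨add_nonneg (Real.sqrt_nonneg _) hK, ?_⟩
  set u := Real.sqrt (c + scatter m C x) with hu
  have hu0 : 0 ≤ u := Real.sqrt_nonneg _
  have hu2 : u ^ 2 = c + scatter m C x := Real.sq_sqrt (by linarith)
  rw [scatter_add_single hm x i hs]
  split_ifs with hi
  · have h1 := mul_sq_le_scatter hm x hi
    have h2 : |s * (m i * ((x i : ℝ) - centroid m C x))| ≤ K * u := by
      refine abs_le_of_sq_le_sq ?_ (by positivity)
      have hs' : (s : ℝ) ^ 2 = 1 := by exact_mod_cast hs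
      calc (s * (m i * ((x i : ℝ) - centroid m C x))) ^ 2
          = m i * (m i * ((x i : ℝ) - centroid m C x) ^ 2) := by rw [mul_pow, hs']; ring
        _ ≤ K ^ 2 * u ^ 2 := by
          refine mul_le_mul (hmK i) (by linarith) (mul_nonneg (hm i).le (sq_nonneg _)) (sq_nonneg _)
        _ = (K * u) ^ 2 := by ring
    have h3 := (abs_le.1 h2).2
    have h4 : 0 ≤ m i ^ 2 / ∑ j ∈ C, m j :=
      div_nonneg (sq_nonneg _) (Finset.sum_nonneg fun j _ => (hm j).le)
    nlinarith [hmK i]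
  · nlinarith

theorem abs_sqrt_scatter_add_single_sub_le (hm : ∀ i, 0 < m i) (x : Fin N → ℤ) (i : Fin N) {s : ℤ}
    (hs : s ^ 2 = 1) {c K : ℝ} (hc : 0 ≤ c) (hK : 0 ≤ K) (hmK : ∀ i, m i ≤ K ^ 2) :
    |Real.sqrt (c + scatter m C (x + Pi.single i s)) - Real.sqrt (c + scatter m C x)| ≤ K := by
  have h1 := sqrt_scatter_add_single_le (C := C) hm x i hs hc hK hmK
  have h2 := sqrt_scatter_add_single_le (C := C) hm (x + Pi.single i s) i (s := -s)
    (by rw [neg_sq, hs]) hc hK hmK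
  rw [add_assoc, ← Pi.single_add, add_neg_cancel, Pi.single_zero, add_zero] at h2
  rw [abs_le]
  constructor <;> linarith

theorem sub_single_eq (x : Fin N → ℤ) (i : Fin N) :
    x - Pi.single i 1 = x + Pi.single i (-1) := by
  rw [sub_eq_add_neg, ← Pi.single_neg]

end Centroid

/-! ### Moment of inertia against spread. -/

section Spread

variable {N : ℕ} {m : Fin N → ℝ} {p q : ℕ}

theorem block_nonempty (hpq : p < q) (hq : q ≤ N) : (block N p q).Nonempty :=
  ⟨⟨p, by omega⟩, mem_block.2 ⟨le_rfl, hpq⟩⟩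

theorem centroid_block_le (hm : ∀ i, 0 < m i) (hpq : p < q) (hq : q ≤ N) (x : Config N) :
    centroid m (block N p q) x.1 ≤ x.1 ⟨q - 1, by omega⟩ := by
  refine centroid_le hm (block_nonempty hpq hq) fun i hi => ?_
  have := (mem_block.1 hi).2
  exact Int.cast_le.2 (x.2 (Fin.le_def.2 (by simp only; omega)))

theorem le_centroid_block (hm : ∀ i, 0 < m i) (hpq : p < q) (hq : q ≤ N) (x : Config N) :
    (x.1 ⟨p, by omega⟩ : ℝ) ≤ centroid m (block N p q) x.1 := by
  refine le_centroid hm (block_nonempty hpq hq) fun i hi => ?_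
  exact Int.cast_le.2 (x.2 (Fin.le_def.2 (mem_block.1 hi).1))

/-- Turns a drift proportional to the spread into one for the root of the moment. The converse,
`mul_sq_spread_le_scatter`, turns tails of the moment into tails of the spread. -/
theorem scatter_block_le (hm : ∀ i, 0 < m i) (hpq : p < q) (hq : q ≤ N) (x : Config N) :
    scatter m (block N p q) x.1 ≤ (∑ i ∈ block N p q, m i) *
      ((x.1 ⟨q - 1, by omega⟩ : ℝ) - x.1 ⟨p, by omega⟩) ^ 2 := by
  rw [scatter, Finset.sum_mul]
  refine Finset.sum_le_sum fun i hi => mul_le_mul_of_nonneg_left ?_ (hm i).le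
  have h1 := centroid_block_le hm hpq hq x
  have h2 := le_centroid_block hm hpq hq x
  have h3 : (x.1 i : ℝ) ≤ x.1 ⟨q - 1, by omega⟩ := by
    have := (mem_block.1 hi).2
    exact Int.cast_le.2 (x.2 (Fin.le_def.2 (by simp only; omega)))
  have h4 : (x.1 ⟨p, by omega⟩ : ℝ) ≤ x.1 i :=
    Int.cast_le.2 (x.2 (Fin.le_def.2 (mem_block.1 hi).1))
  refine sq_le_sq' ?_ ?_ <;> linarith

theorem mul_sq_spread_le_scatter (hm : ∀ i, 0 < m i) (hpq : p < q) (hq : q ≤ N) {c : ℝ}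
    (hc0 : 0 < c) (hc : ∀ i, c ≤ m i) (x : Config N) :
    c * ((x.1 ⟨q - 1, by omega⟩ : ℝ) - x.1 ⟨p, by omega⟩) ^ 2 ≤
      4 * scatter m (block N p q) x.1 := by
  have h1 := mul_sq_le_scatter (C := block N p q) hm x.1 (i := ⟨q - 1, by omega⟩)
    (mem_block.2 ⟨by simp only; omega, by simp only; omega⟩)
  have h2 := mul_sq_le_scatter (C := block N p q) hm x.1 (i := ⟨p, by omega⟩)
    (mem_block.2 ⟨le_rfl, hpq⟩)
  have h3 := mul_le_mul_of_nonneg_right (hc ⟨q - 1, by omega⟩)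
    (sq_nonneg ((x.1 ⟨q - 1, by omega⟩ : ℝ) - centroid m (block N p q) x.1))
  have h4 := mul_le_mul_of_nonneg_right (hc ⟨p, by omega⟩)
    (sq_nonneg ((x.1 ⟨p, by omega⟩ : ℝ) - centroid m (block N p q) x.1))
  set W := centroid m (block N p q) x.1
  set u := (x.1 ⟨q - 1, by omega⟩ : ℝ)
  set t := (x.1 ⟨p, by omega⟩ : ℝ)
  have h5 : (u - t) ^ 2 ≤ 2 * (u - W) ^ 2 + 2 * (t - W) ^ 2 := by
    nlinarith [sq_nonneg (u - W + (t - W))]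
  have h6 := mul_le_mul_of_nonneg_left h5 hc0.le
  linarith

end Spread

/-! ### Drift of the moment of inertia of a block. -/

section Drift

variable {N : ℕ} {m a b : Fin N → ℝ}

theorem jumpMean_sub {x : Config N} (hT : totalRate m a b x ≠ 0) (φ : (Fin N → ℤ) → ℝ) :
    jumpMean m a b x φ - φ x.1 =
      (∑ i, leftRate m a x i * (φ (x.1 + Pi.single i (-1)) - φ x.1) +
        ∑ i, rightRate m b x i * (φ (x.1 + Pi.single i 1) - φ x.1)) / totalRate m a b x := by
  rw [jumpMean, eq_div_iff hT, sub_mul, div_mul_cancel₀ _ hT, totalRate, Finset.mul_sum,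
    ← Finset.sum_sub_distrib, ← Finset.sum_add_distrib]
  refine Finset.sum_congr rfl fun i _ => ?_
  rw [sub_single_eq]
  ring

/-- The interaction, including that with particles outside the block, does not increase the
first-order part of the drift of the moment of inertia of a block. -/
theorem sum_rate_mul_sub_centroid_le (hm : ∀ i, 0 < m i) (ha : ∀ i, 0 ≤ a i) (hb : ∀ i, 0 ≤ b i)
    {p q : ℕ} (hpq : p < q) (hq : q ≤ N) (x : Config N) :
    ∑ i, rightRate m b x i * (if i ∈ block N p q then
          m i * ((x.1 i : ℝ) - centroid m (block N p q) x.1) else 0) -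
        ∑ i, leftRate m a x i * (if i ∈ block N p q then
          m i * ((x.1 i : ℝ) - centroid m (block N p q) x.1) else 0) ≤
      ∑ j ∈ block N p q, m j * (b j - a j) * ((x.1 j : ℝ) - centroid m (block N p q) x.1) := by
  classical
  rw [sum_rightRate_mul, sum_leftRate_mul, ← Finset.sum_sub_distrib]
  have hW1 := centroid_block_le hm hpq hq x
  have hW2 := le_centroid_block hm hpq hq x
  set W := centroid m (block N p q) x.1
  -- The mass in the rate cancels the mass that moves, and a stack has a single position. The
  -- impulse of `j` thus acts as at `j` itself, save for the block membership of the stack's end.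
  have ht : ∀ j, m j * b j / m (stackTop x.1 j) * (if stackTop x.1 j ∈ block N p q then
      m (stackTop x.1 j) * ((x.1 (stackTop x.1 j) : ℝ) - W) else 0) =
      m j * b j * (if stackTop x.1 j ∈ block N p q then (x.1 j : ℝ) - W else 0) := by
    intro j
    rw [apply_stackTop x.1 j]
    split_ifs
    · have := (hm (stackTop x.1 j)).ne'; field_simp
    · simp
  have hbt : ∀ j, m j * a j / m (stackBot x.1 j) * (if stackBot x.1 j ∈ block N p q then
      m (stackBot x.1 j) * ((x.1 (stackBot x.1 j) : ℝ) - W) else 0) =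
      m j * a j * (if stackBot x.1 j ∈ block N p q then (x.1 j : ℝ) - W else 0) := by
    intro j
    rw [apply_stackBot x.1 j]
    split_ifs
    · have := (hm (stackBot x.1 j)).ne'; field_simp
    · simp
  have hup : ∀ j : Fin N, q - 1 ≤ (j : ℕ) → W ≤ x.1 j := fun j hj =>
    hW1.trans (Int.cast_le.2 (x.2 (Fin.le_def.2 hj)))
  have hdown : ∀ j : Fin N, (j : ℕ) ≤ p → (x.1 j : ℝ) ≤ W := fun j hj =>
    le_trans (Int.cast_le.2 (x.2 (Fin.le_def.2 hj))) hW2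
  -- If only the top lies in the block, `j` is to the left of it and `x j ≤ W`; if only `j` does,
  -- the stack reaches past the last particle of the block and `x j ≥ W`.
  have hle1 : ∀ j, (if stackTop x.1 j ∈ block N p q then (x.1 j : ℝ) - W else 0) ≤
      if j ∈ block N p q then (x.1 j : ℝ) - W else 0 := by
    intro j
    have h1 : j ≤ stackTop x.1 j := le_stackTop rfl
    rw [Fin.le_def] at h1
    split_ifs with h2 h3 h3
    · exact le_rfl
    · rw [mem_block] at h2 h3
      have := hdown j (by omega)
      linarith
    · rw [mem_block] at h2 h3
      have := hup (stackTop x.1 j) (by omega)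
      rw [apply_stackTop x.1 j] at this
      linarith
    · exact le_rfl
  have hle2 : ∀ j, (if j ∈ block N p q then (x.1 j : ℝ) - W else 0) ≤
      if stackBot x.1 j ∈ block N p q then (x.1 j : ℝ) - W else 0 := by
    intro j
    have h1 : stackBot x.1 j ≤ j := stackBot_le rfl
    rw [Fin.le_def] at h1
    split_ifs with h2 h3 h3
    · exact le_rfl
    · rw [mem_block] at h2 h3
      have := hdown (stackBot x.1 j) (by omega)
      rw [apply_stackBot x.1 j] at this
      linarith
    · rw [mem_block] at h2 h3
      have := hup j (by omega)
      linarith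
    · exact le_rfl
  simp_rw [ht, hbt]
  have hconv : ∑ j ∈ block N p q, m j * (b j - a j) * ((x.1 j : ℝ) - W) =
      ∑ j, (m j * b j * (if j ∈ block N p q then (x.1 j : ℝ) - W else 0) -
        m j * a j * (if j ∈ block N p q then (x.1 j : ℝ) - W else 0)) := by
    rw [← Finset.sum_subset (Finset.subset_univ (block N p q))]
    · refine Finset.sum_congr rfl fun j hj => ?_
      rw [if_pos hj]; ring
    · intro j _ hj
      rw [if_neg hj]; simp
  rw [hconv]
  exact Finset.sum_le_sum fun j _ => sub_le_sub
    (mul_le_mul_of_nonneg_left (hle1 j) (mul_nonneg (hm j).le (hb j)))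
    (mul_le_mul_of_nonneg_left (hle2 j) (mul_nonneg (hm j).le (ha j)))

/-- The moment of inertia of a block on which the centred intrinsic drifts have nonnegative
partial sums and total `0` decreases at least at a rate given by its spread, up to a constant. -/
theorem jumpMean_scatter_sub_le (hm : ∀ i, 0 < m i) (ha : ∀ i, 0 ≤ a i) (hb : ∀ i, 0 ≤ b i)
    {x : Config N} (hT : totalRate m a b x ≠ 0) {p q : ℕ} (hpq : p < q) (hq : q ≤ N) {v δ K : ℝ}
    (hK : ∀ i, m i ≤ K)
    (h0 : ∑ i ∈ block N p q, m i * (b i - a i + v) = 0)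
    (hδ : ∀ k, p < k → k < q → δ ≤ ∑ i ∈ block N p k, m i * (b i - a i + v)) :
    jumpMean m a b x (scatter m (block N p q)) - scatter m (block N p q) x.1 ≤
      -(2 * δ * ((x.1 ⟨q - 1, by omega⟩ : ℝ) - x.1 ⟨p, by omega⟩)) / totalRate m a b x + K := by
  have hTp : 0 < totalRate m a b x := lt_of_le_of_ne (totalRate_nonneg hm ha hb x) hT.symm
  have hne := block_nonempty hpq hq
  have key := sum_rate_mul_sub_centroid_le hm ha hb hpq hq x
  have h1 := sum_mul_sub_centroid hm hne x.1
  set W := centroid m (block N p q) x.1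
  -- Adding `v` is free because deviations from the centre of mass have weighted sum zero; dropping
  -- `W` is free because the centred drifts sum to zero.
  have h2 : ∑ j ∈ block N p q, m j * (b j - a j) * ((x.1 j : ℝ) - W) =
      ∑ j ∈ block N p q, m j * (b j - a j + v) * (x.1 j : ℝ) := by
    have e : ∀ j, m j * (b j - a j) * ((x.1 j : ℝ) - W) = m j * (b j - a j + v) * (x.1 j : ℝ) -
        W * (m j * (b j - a j + v)) - v * (m j * ((x.1 j : ℝ) - W)) := fun j => by ring
    rw [Finset.sum_congr rfl fun j _ => e j, Finset.sum_sub_distrib, Finset.sum_sub_distrib,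
      ← Finset.mul_sum, ← Finset.mul_sum, h0, h1]
    ring
  have h3 := sum_mul_block_le (y := fun j => (x.1 j : ℝ)) (fun i j h => Int.cast_le.2 (x.2 h)) hpq hq hδ
  rw [h0, zero_mul, zero_sub] at h3
  rw [jumpMean_sub hT, div_add' _ _ _ hT]
  refine div_le_div_of_nonneg_right ?_ hTp.le
  have hi : ∀ (i : Fin N) (s : ℤ), s ^ 2 = 1 → scatter m (block N p q) (x.1 + Pi.single i s) -
      scatter m (block N p q) x.1 ≤ 2 * s * (if i ∈ block N p q then
        m i * ((x.1 i : ℝ) - W) else 0) + K := by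
    intro i s hs
    rw [scatter_add_single hm x.1 i hs]
    have h5 : 0 ≤ m i ^ 2 / ∑ j ∈ block N p q, m j :=
      div_nonneg (sq_nonneg _) (Finset.sum_nonneg fun j _ => (hm j).le)
    have h6 := hK i
    have h7 := hm i
    split_ifs <;> linarith
  have hL : ∑ i, leftRate m a x i * (scatter m (block N p q) (x.1 + Pi.single i (-1)) -
      scatter m (block N p q) x.1) ≤ -2 * ∑ i, leftRate m a x i * (if i ∈ block N p q then
        m i * ((x.1 i : ℝ) - W) else 0) + (∑ i, leftRate m a x i) * K := by
    rw [Finset.mul_sum, Finset.sum_mul, ← Finset.sum_add_distrib]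
    refine Finset.sum_le_sum fun i _ => ?_
    refine (mul_le_mul_of_nonneg_left (hi i (-1) rfl) (leftRate_nonneg hm ha x i)).trans_eq ?_
    push_cast; ring
  have hR : ∑ i, rightRate m b x i * (scatter m (block N p q) (x.1 + Pi.single i 1) -
      scatter m (block N p q) x.1) ≤ 2 * ∑ i, rightRate m b x i * (if i ∈ block N p q then
        m i * ((x.1 i : ℝ) - W) else 0) + (∑ i, rightRate m b x i) * K := by
    rw [Finset.mul_sum, Finset.sum_mul, ← Finset.sum_add_distrib]
    refine Finset.sum_le_sum fun i _ => ?_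
    refine (mul_le_mul_of_nonneg_left (hi i 1 rfl) (rightRate_nonneg hm hb x i)).trans_eq ?_
    push_cast; ring
  rw [totalRate, Finset.sum_add_distrib]
  linarith

end Drift

/-! ### Tightness of a block, and the distance of the centres of mass. -/

section Gap

variable {N : ℕ} {m a b : Fin N → ℝ}

/-- With `u` the root and `S` the spread, `u ≤ 1 + √M S`, so the moment has drift at most `-2η(u -
1) + Kb`. Dividing by `2u` gives `-η + (η + Kb/2)/u`, as `exists_exp_drift_bound` requires. -/
theorem exists_exp_scatter_bound (hm : ∀ i, 0 < m i) (ha : ∀ i, 0 ≤ a i) (hb : ∀ i, 0 ≤ b i)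
    (hT : ∀ x, totalRate m a b x ≠ 0) {p q : ℕ} (hpq : p < q) (hq : q ≤ N) {v : ℝ}
    (h0 : ∑ i ∈ block N p q, m i * (b i - a i + v) = 0)
    (hpos : ∀ k, p < k → k < q → 0 < ∑ i ∈ block N p k, m i * (b i - a i + v)) :
    ∃ θ C : ℝ, 0 < θ ∧ 0 ≤ C ∧ ∀ x : Config N,
      jumpMean m a b x (fun y => Real.exp (θ * Real.sqrt (1 + scatter m (block N p q) y))) ≤
        Real.exp (θ * Real.sqrt (1 + scatter m (block N p q) x.1)) + C := by
  obtain ⟨δ, hδ0, hδ⟩ : ∃ δ : ℝ, 0 < δ ∧ ∀ k, p < k → k < q →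
      δ ≤ ∑ i ∈ block N p k, m i * (b i - a i + v) := by
    rcases (Finset.Ioo p q).eq_empty_or_nonempty with he | hne
    -- A one-particle block has no interior index, so any `δ` will do.
    · refine ⟨1, one_pos, fun k hk hkq => ?_⟩
      have : k ∈ Finset.Ioo p q := Finset.mem_Ioo.2 ⟨hk, hkq⟩
      simp [he] at this
    · obtain ⟨k, hk, hmin⟩ := Finset.exists_min_image (Finset.Ioo p q)
        (fun k => ∑ i ∈ block N p k, m i * (b i - a i + v)) hne
      rw [Finset.mem_Ioo] at hk
      exact ⟨_, hpos k hk.1 hk.2, fun l hl hlq => hmin l (Finset.mem_Ioo.2 ⟨hl, hlq⟩)⟩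
  obtain ⟨Λ, hΛ, hTΛ⟩ := exists_totalRate_le hm ha hb
  have hM := sum_mass_pos hm (block_nonempty hpq hq)
  set M := ∑ i ∈ block N p q, m i with hMdef
  set Kb := ∑ i, m i with hKb
  have hmK : ∀ i, m i ≤ Kb := fun i =>
    Finset.single_le_sum (fun j _ => (hm j).le) (Finset.mem_univ i)
  have hKb0 : 0 < Kb := (hm ⟨p, by omega⟩).trans_le (hmK _)
  have hsq : Real.sqrt Kb ^ 2 = Kb := Real.sq_sqrt hKb0.le
  set η := δ / (Λ * Real.sqrt M) with hη
  have hη0 : 0 < η := by positivity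
  refine exists_exp_drift_bound hm ha hb hT (f := fun y => Real.sqrt (1 + scatter m (block N p q) y))
    (K := Real.sqrt Kb) (η := η) (B := η + Kb / 2) (Real.sqrt_pos.2 hKb0) hη0 (by positivity)
    (fun y => ?_) (fun x i => ?_) (fun x i => ?_) fun x => ?_
  · rw [Real.one_le_sqrt]
    linarith [scatter_nonneg (C := block N p q) hm y]
  · rw [sub_single_eq]
    exact abs_sqrt_scatter_add_single_sub_le hm x.1 i rfl zero_le_one (Real.sqrt_nonneg _)
      fun i => (hmK i).trans_eq hsq.symm
  · exact abs_sqrt_scatter_add_single_sub_le hm x.1 i rfl zero_le_one (Real.sqrt_nonneg _)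
      fun i => (hmK i).trans_eq hsq.symm
  · have h1 := jumpMean_sqrt_sub_le hm ha hb (hT x) (scatter_nonneg (C := block N p q) hm) one_pos
    have h2 := jumpMean_scatter_sub_le hm ha hb (hT x) hpq hq hmK h0 hδ
    have h3 := scatter_block_le hm hpq hq x
    have hs0 := scatter_nonneg (C := block N p q) hm x.1
    have hS0 : (0 : ℝ) ≤ (x.1 ⟨q - 1, by omega⟩ : ℝ) - x.1 ⟨p, by omega⟩ :=
      sub_nonneg.2 (Int.cast_le.2 (x.2 (Fin.le_def.2 (by simp only; omega))))
    set S := (x.1 ⟨q - 1, by omega⟩ : ℝ) - x.1 ⟨p, by omega⟩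
    set u := Real.sqrt (1 + scatter m (block N p q) x.1) with hu
    have hu0 : 0 < u := Real.sqrt_pos.2 (by linarith)
    have hTp : 0 < totalRate m a b x := lt_of_le_of_ne (totalRate_nonneg hm ha hb x) (hT x).symm
    have h4 : u ≤ 1 + Real.sqrt M * S := by
      refine Real.sqrt_le_iff.2 ⟨by positivity, ?_⟩
      have h5 := Real.sq_sqrt hM.le
      have h6 : 0 ≤ Real.sqrt M * S := by positivity
      have h7 : (Real.sqrt M * S) ^ 2 = M * S ^ 2 := by rw [mul_pow, h5]
      nlinarith
    have h5 : 2 * η * (u - 1) ≤ 2 * δ * S / totalRate m a b x := by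
      calc 2 * η * (u - 1) ≤ 2 * η * (Real.sqrt M * S) := by
            apply mul_le_mul_of_nonneg_left _ (by positivity); linarith
        _ = 2 * δ * S / Λ := by
            rw [hη]; field_simp
        _ ≤ 2 * δ * S / totalRate m a b x :=
            div_le_div_of_nonneg_left (by positivity) hTp (hTΛ x)
    have h6 : jumpMean m a b x (scatter m (block N p q)) - scatter m (block N p q) x.1 ≤
        -(2 * η * (u - 1)) + Kb := by
      rw [neg_div] at h2; linarith
    refine h1.trans ((div_le_div_of_nonneg_right h6 (by positivity)).trans_eq ?_)
    field_simp; ring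

/-- The distance between the centres of mass of `[0, k₁)` and `[k₂, N)`. -/
noncomputable def centroidGap (m : Fin N → ℝ) (k₁ k₂ : ℕ) (x : Fin N → ℤ) : ℝ :=
  centroid m (block N k₂ N) x - centroid m (block N 0 k₁) x

variable {k₁ k₂ : ℕ}

/-- The two blocks are disjoint, and a jump shifts the centre of mass of its own block by the mass
fraction of one particle. -/
theorem abs_centroidGap_add_single_sub_le (hm : ∀ i, 0 < m i) (hk : k₁ ≤ k₂)
    (x : Fin N → ℤ) (i : Fin N) {s : ℤ} (hs : s ^ 2 = 1) :
    |centroidGap m k₁ k₂ (x + Pi.single i s) - centroidGap m k₁ k₂ x| ≤ 1 := by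
  have hs' : |(s : ℝ)| = 1 := by
    rw [← sq_eq_sq₀ (abs_nonneg _) zero_le_one, sq_abs, one_pow]; exact_mod_cast hs
  have hle : ∀ C : Finset (Fin N), i ∈ C → |(s : ℝ) * (m i / ∑ j ∈ C, m j)| ≤ 1 := by
    intro C hi
    have h1 : m i ≤ ∑ j ∈ C, m j := Finset.single_le_sum (fun j _ => (hm j).le) hi
    rw [abs_mul, hs', one_mul, abs_of_nonneg (div_nonneg (hm i).le ((hm i).le.trans h1))]
    exact div_le_one_of_le₀ h1 ((hm i).le.trans h1)
  rw [centroidGap, centroidGap, centroid_add_single, centroid_add_single]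
  split_ifs with h1 h2 h2
  · rw [mem_block] at h1 h2; omega
  · convert hle _ h1 using 2; ring
  · rw [← abs_neg]; convert hle _ h2 using 2; ring
  · simp

/-- Momentum balance: the jumping mass cancels, and the impulse of `j` counts precisely when the end
of its stack lies in `C`. -/
theorem jumpMean_centroid_sub (hm : ∀ i, 0 < m i) {x : Config N} (hT : totalRate m a b x ≠ 0)
    (C : Finset (Fin N)) : jumpMean m a b x (centroid m C) - centroid m C x.1 =
      (∑ j, (m j * b j * (if stackTop x.1 j ∈ C then 1 else 0) -
        m j * a j * (if stackBot x.1 j ∈ C then 1 else 0))) / (∑ j ∈ C, m j) /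
          totalRate m a b x := by
  rw [jumpMean_sub hT]
  congr 1
  rw [sum_leftRate_mul, sum_rightRate_mul, ← Finset.sum_add_distrib, Finset.sum_div]
  refine Finset.sum_congr rfl fun j _ => ?_
  have h1 := (hm (stackTop x.1 j)).ne'
  have h2 := (hm (stackBot x.1 j)).ne'
  rw [centroid_add_single, centroid_add_single]
  push_cast
  split_ifs <;> field_simp <;> ring

/-- The velocity the centre of mass would have if every impulse stayed in the block of its origin.
-/
theorem sum_block_mul_eq (C : Finset (Fin N)) {v : ℝ} (hC : 0 < ∑ j ∈ C, m j)
    (h0 : ∑ i ∈ C, m i * (b i - a i + v) = 0) :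
    (∑ j, (m j * b j * (if j ∈ C then 1 else 0) - m j * a j * (if j ∈ C then 1 else 0))) /
      (∑ j ∈ C, m j) = -v := by
  rw [div_eq_iff hC.ne', ← Finset.sum_subset (Finset.subset_univ C)]
  · have e : ∀ i, m i * (b i - a i + v) = (m i * b i - m i * a i) + v * m i := fun i => by ring
    rw [Finset.sum_congr rfl fun i _ => e i, Finset.sum_add_distrib, ← Finset.mul_sum] at h0
    rw [Finset.sum_congr rfl fun i hi => by rw [if_pos hi, mul_one, mul_one]]
    linarith
  · intro j _ hj
    simp [hj]

/-- The centre of mass of the first cloud drifts to the right at speed at most `-v`, that of the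
last one at speed at least `-v`. -/
theorem centroidGap_le_jumpMean (hm : ∀ i, 0 < m i) (ha : ∀ i, 0 ≤ a i) (hb : ∀ i, 0 ≤ b i)
    {x : Config N} (hT : totalRate m a b x ≠ 0) (hk₁ : 0 < k₁) (hk : k₁ ≤ k₂) (hk₂ : k₂ < N) {v : ℝ}
    (h1 : ∑ i ∈ block N 0 k₁, m i * (b i - a i + v) = 0)
    (h2 : ∑ i ∈ block N k₂ N, m i * (b i - a i + v) = 0) :
    centroidGap m k₁ k₂ x.1 ≤ jumpMean m a b x (centroidGap m k₁ k₂) := by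
  have hTp := totalRate_nonneg hm ha hb x
  have hM1 := sum_mass_pos hm (block_nonempty (N := N) hk₁ (by omega))
  have hM2 := sum_mass_pos hm (block_nonempty (N := N) hk₂ le_rfl)
  -- The first block starts at label `0`: right impulses can leave it but not enter, left impulses
  -- can enter but not leave. For the last block the roles are reversed.
  have e1 : jumpMean m a b x (centroid m (block N 0 k₁)) - centroid m (block N 0 k₁) x.1 ≤
      -v / totalRate m a b x := by
    rw [jumpMean_centroid_sub hm hT, ← sum_block_mul_eq (block N 0 k₁) hM1 h1]
    refine div_le_div_of_nonneg_right (div_le_div_of_nonneg_right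
      (Finset.sum_le_sum fun j _ => sub_le_sub (mul_le_mul_of_nonneg_left ?_
        (mul_nonneg (hm j).le (hb j))) (mul_le_mul_of_nonneg_left ?_
        (mul_nonneg (hm j).le (ha j)))) hM1.le) hTp
    · have h : j ≤ stackTop x.1 j := le_stackTop rfl
      rw [Fin.le_def] at h
      simp only [mem_block]
      split_ifs <;> first | omega | norm_num
    · have h : stackBot x.1 j ≤ j := stackBot_le rfl
      rw [Fin.le_def] at h
      simp only [mem_block]
      split_ifs <;> first | omega | norm_num
  have e2 : -v / totalRate m a b x ≤
      jumpMean m a b x (centroid m (block N k₂ N)) - centroid m (block N k₂ N) x.1 := by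
    rw [jumpMean_centroid_sub hm hT, ← sum_block_mul_eq (block N k₂ N) hM2 h2]
    refine div_le_div_of_nonneg_right (div_le_div_of_nonneg_right
      (Finset.sum_le_sum fun j _ => sub_le_sub (mul_le_mul_of_nonneg_left ?_
        (mul_nonneg (hm j).le (hb j))) (mul_le_mul_of_nonneg_left ?_
        (mul_nonneg (hm j).le (ha j)))) hM2.le) hTp
    · have h : j ≤ stackTop x.1 j := le_stackTop rfl
      rw [Fin.le_def] at h
      simp only [mem_block]
      split_ifs <;> first | omega | norm_num
    · have h : stackBot x.1 j ≤ j := stackBot_le rfl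
      rw [Fin.le_def] at h
      simp only [mem_block]
      split_ifs <;> first | omega | norm_num
  have e3 : jumpMean m a b x (centroidGap m k₁ k₂) =
      jumpMean m a b x (centroid m (block N k₂ N)) - jumpMean m a b x (centroid m (block N 0 k₁)) := by
    have : centroidGap m k₁ k₂ = fun y => centroid m (block N k₂ N) y +
        (-1) * centroid m (block N 0 k₁) y := by
      funext y; rw [centroidGap]; ring
    rw [this, jumpMean_add, jumpMean_const_mul]
    ring
  rw [e3, centroidGap]
  linarith

/-- A left impulse in the first block is executed by a lower label, hence inside that block, and
always moves its centre of mass; likewise for right impulses in the last block. Other impulses may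
be passed on to particles between the blocks. -/
theorem exists_le_jumpMean_sq (hm : ∀ i, 0 < m i) (ha : ∀ i, 0 ≤ a i) (hb : ∀ i, 0 ≤ b i)
    (hT : ∀ x, totalRate m a b x ≠ 0) (hk : k₁ ≤ k₂)
    (h : (∃ j ∈ block N 0 k₁, 0 < a j) ∨ ∃ j ∈ block N k₂ N, 0 < b j) :
    ∃ σ : ℝ, 0 < σ ∧ ∀ x : Config N,
      σ ≤ jumpMean m a b x fun y => (centroidGap m k₁ k₂ y - centroidGap m k₁ k₂ x.1) ^ 2 := by
  obtain ⟨Λ, hΛ, hTΛ⟩ := exists_totalRate_le hm ha hb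
  have hTp : ∀ x, 0 < totalRate m a b x := fun x =>
    lt_of_le_of_ne (totalRate_nonneg hm ha hb x) (hT x).symm
  have hsplit : ∀ x : Config N, jumpMean m a b x
      (fun y => (centroidGap m k₁ k₂ y - centroidGap m k₁ k₂ x.1) ^ 2) =
      (∑ j, m j * a j / m (stackBot x.1 j) * (centroidGap m k₁ k₂
          (x.1 + Pi.single (stackBot x.1 j) (-1)) - centroidGap m k₁ k₂ x.1) ^ 2 +
        ∑ j, m j * b j / m (stackTop x.1 j) * (centroidGap m k₁ k₂
          (x.1 + Pi.single (stackTop x.1 j) 1) - centroidGap m k₁ k₂ x.1) ^ 2) /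
        totalRate m a b x := by
    intro x
    have := jumpMean_sub (hT x)
      fun y => (centroidGap m k₁ k₂ y - centroidGap m k₁ k₂ x.1) ^ 2
    simp only [sub_self, ne_eq, OfNat.ofNat_ne_zero, not_false_eq_true, zero_pow, sub_zero] at this
    rw [this, sum_leftRate_mul, sum_rightRate_mul]
  have hnl : ∀ (x : Config N) j, 0 ≤ m j * a j / m (stackBot x.1 j) * (centroidGap m k₁ k₂
          (x.1 + Pi.single (stackBot x.1 j) (-1)) - centroidGap m k₁ k₂ x.1) ^ 2 := fun x j =>
    mul_nonneg (div_nonneg (mul_nonneg (hm j).le (ha j)) (hm _).le) (sq_nonneg _)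
  have hnr : ∀ (x : Config N) j, 0 ≤ m j * b j / m (stackTop x.1 j) * (centroidGap m k₁ k₂
          (x.1 + Pi.single (stackTop x.1 j) 1) - centroidGap m k₁ k₂ x.1) ^ 2 := fun x j =>
    mul_nonneg (div_nonneg (mul_nonneg (hm j).le (hb j)) (hm _).le) (sq_nonneg _)
  have hmin : ∀ j : Fin N, ∃ c : ℝ, 0 < c ∧ ∀ i, c ≤ m i := by
    intro j
    obtain ⟨i, -, hi⟩ := Finset.exists_min_image Finset.univ m ⟨j, Finset.mem_univ j⟩
    exact ⟨m i, hm i, fun k => hi k (Finset.mem_univ k)⟩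
  rcases h with ⟨j, hj, haj⟩ | ⟨j, hj, hbj⟩
  · obtain ⟨c, hc, hcm⟩ := hmin j
    have hM := sum_mass_pos hm (C := block N 0 k₁) ⟨j, hj⟩
    refine ⟨m j * a j * c / (∑ i ∈ block N 0 k₁, m i) ^ 2 / Λ, by have := hm j; positivity,
      fun x => ?_⟩
    rw [hsplit]
    have hle : stackBot x.1 j ≤ j := stackBot_le rfl
    rw [Fin.le_def] at hle
    rw [mem_block] at hj
    have hin : stackBot x.1 j ∈ block N 0 k₁ := mem_block.2 ⟨by omega, by omega⟩
    have hout : stackBot x.1 j ∉ block N k₂ N := fun h => by rw [mem_block] at h; omega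
    refine div_le_div₀ (add_nonneg (Finset.sum_nonneg fun j _ => hnl x j)
      (Finset.sum_nonneg fun j _ => hnr x j)) ?_ (hTp x) (hTΛ x)
    refine le_trans ?_ (le_add_of_nonneg_right (Finset.sum_nonneg fun j _ => hnr x j))
    refine le_trans ?_ (Finset.single_le_sum (fun j _ => hnl x j) (Finset.mem_univ j))
    rw [centroidGap, centroidGap, centroid_add_single, centroid_add_single, if_pos hin, if_neg hout]
    have hmb := hm (stackBot x.1 j)
    have e : m j * a j / m (stackBot x.1 j) * (centroid m (block N k₂ N) x.1 + 0 -
        (centroid m (block N 0 k₁) x.1 + ((-1 : ℤ) : ℝ) * (m (stackBot x.1 j) /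
          ∑ i ∈ block N 0 k₁, m i)) - (centroid m (block N k₂ N) x.1 -
            centroid m (block N 0 k₁) x.1)) ^ 2 =
        m j * a j * m (stackBot x.1 j) / (∑ i ∈ block N 0 k₁, m i) ^ 2 := by
      push_cast; field_simp; ring
    rw [e]
    have := hcm (stackBot x.1 j)
    have := hm j
    gcongr
  · obtain ⟨c, hc, hcm⟩ := hmin j
    have hM := sum_mass_pos hm (C := block N k₂ N) ⟨j, hj⟩
    refine ⟨m j * b j * c / (∑ i ∈ block N k₂ N, m i) ^ 2 / Λ, by have := hm j; positivity,
      fun x => ?_⟩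
    rw [hsplit]
    have hle : j ≤ stackTop x.1 j := le_stackTop rfl
    rw [Fin.le_def] at hle
    rw [mem_block] at hj
    have hin : stackTop x.1 j ∈ block N k₂ N := mem_block.2 ⟨by omega, by omega⟩
    have hout : stackTop x.1 j ∉ block N 0 k₁ := fun h => by rw [mem_block] at h; omega
    refine div_le_div₀ (add_nonneg (Finset.sum_nonneg fun j _ => hnl x j)
      (Finset.sum_nonneg fun j _ => hnr x j)) ?_ (hTp x) (hTΛ x)
    refine le_trans ?_ (le_add_of_nonneg_left (Finset.sum_nonneg fun j _ => hnl x j))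
    refine le_trans ?_ (Finset.single_le_sum (fun j _ => hnr x j) (Finset.mem_univ j))
    rw [centroidGap, centroidGap, centroid_add_single, centroid_add_single, if_pos hin, if_neg hout]
    have hmb := hm (stackTop x.1 j)
    have e : m j * b j / m (stackTop x.1 j) * (centroid m (block N k₂ N) x.1 + ((1 : ℤ) : ℝ) *
        (m (stackTop x.1 j) / ∑ i ∈ block N k₂ N, m i) - (centroid m (block N 0 k₁) x.1 + 0) -
          (centroid m (block N k₂ N) x.1 - centroid m (block N 0 k₁) x.1)) ^ 2 =
        m j * b j * m (stackTop x.1 j) / (∑ i ∈ block N k₂ N, m i) ^ 2 := by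
      push_cast; field_simp; ring
    rw [e]
    have := hcm (stackTop x.1 j)
    have := hm j
    gcongr

end Gap

/-! ### A convex test function. -/

section QuadCap

/-- The convex function which is `z ^ 2` up to `R` and is continued linearly beyond `R`. -/
noncomputable def quadCap (R z : ℝ) : ℝ := z ^ 2 - max (z - R) 0 ^ 2

/-- The tangent inequality of a convex function whose derivative at `z` is `2 min z R`. -/
theorem quadCap_add_ge (R z d : ℝ) : quadCap R z + 2 * min z R * d ≤ quadCap R (z + d) := by
  unfold quadCap
  rcases le_total z R with h | h <;> rcases le_total (z + d) R with h' | h'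
  · rw [max_eq_right (by linarith), max_eq_right (by linarith), min_eq_left h]
    nlinarith [sq_nonneg d]
  · rw [max_eq_right (by linarith), max_eq_left (by linarith), min_eq_left h]
    nlinarith
  · rw [max_eq_left (by linarith), max_eq_right (by linarith), min_eq_right h]
    nlinarith [sq_nonneg (z + d - R)]
  · rw [max_eq_left (by linarith), max_eq_left (by linarith), min_eq_right h]
    nlinarith

/-- From `z ≤ R - 1` a step of size at most `1` stays in the quadratic range. -/
theorem quadCap_add_eq {R z d : ℝ} (hz : z ≤ R - 1) (hd : |d| ≤ 1) :
    quadCap R (z + d) = quadCap R z + 2 * min z R * d + d ^ 2 := by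
  have := (abs_le.1 hd).2
  unfold quadCap
  rw [max_eq_right (by linarith), max_eq_right (by linarith), min_eq_left (by linarith)]
  ring

theorem abs_quadCap_add_sub_le {R z d : ℝ} (hR : 1 ≤ R) (hz : 0 ≤ z) (hd : |d| ≤ 1) :
    |quadCap R (z + d) - quadCap R z| ≤ 2 * R := by
  obtain ⟨hd1, hd2⟩ := abs_le.1 hd
  have h1 := quadCap_add_ge R z d
  have h2 := quadCap_add_ge R (z + d) (-d)
  rw [add_neg_cancel_right] at h2
  have h3 : 0 ≤ min z R := le_min hz (by linarith)
  have h4 : min z R ≤ R := min_le_right _ _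
  -- The new point can be negative, as the move need not preserve the order, but it is at least `-1
  -- ≥ -R`.
  have h5 : -R ≤ min (z + d) R := le_min (by linarith) (by linarith)
  have h6 : min (z + d) R ≤ R := min_le_right _ _
  rw [abs_le]
  constructor
  · nlinarith
  · have h7 : |min (z + d) R * d| ≤ R * 1 := by
      rw [abs_mul]
      exact mul_le_mul (abs_le.2 ⟨h5, h6⟩) hd (abs_nonneg _) (by linarith)
    have := (abs_le.1 h7).2
    linarith

theorem quadCap_le {R z : ℝ} (hR : 0 ≤ R) (hz : 0 ≤ z) : quadCap R z ≤ 2 * R * z := by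
  unfold quadCap
  rcases le_total z R with h | h
  · rw [max_eq_right (by linarith)]; nlinarith
  · rw [max_eq_left (by linarith)]; nlinarith

end QuadCap

/-! ### The Lyapunov function for small distances. -/

section Count

variable {N : ℕ} {m a b : Fin N → ℝ} {k₁ k₂ : ℕ}

theorem centroidGap_nonneg (hm : ∀ i, 0 < m i) (hk₁ : 0 < k₁) (hk : k₁ ≤ k₂) (hk₂ : k₂ < N)
    (x : Config N) : 0 ≤ centroidGap m k₁ k₂ x.1 := by
  have h1 := centroid_block_le hm hk₁ (by omega) x
  have h2 := le_centroid_block hm hk₂ le_rfl x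
  have h3 : (x.1 ⟨k₁ - 1, by omega⟩ : ℝ) ≤ x.1 ⟨k₂, hk₂⟩ :=
    Int.cast_le.2 (x.2 (Fin.le_def.2 (by simp only; omega)))
  rw [centroidGap]
  linarith

theorem centroidGap_le (hm : ∀ i, 0 < m i) (hk₁ : 0 < k₁) (hk : k₁ ≤ k₂) (hk₂ : k₂ < N)
    (x : Config N) : centroidGap m k₁ k₂ x.1 ≤
      (x.1 ⟨N - 1, by omega⟩ : ℝ) - x.1 ⟨0, by omega⟩ := by
  have h1 := le_centroid_block hm hk₁ (by omega) x
  have h2 := centroid_block_le hm hk₂ le_rfl x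
  rw [centroidGap]
  linarith

/-- A function of the configuration which shows that the centres of mass of the two extreme
clouds spend time of order `R √n` within distance `R` of each other. -/
theorem exists_count_lyapunov (hm : ∀ i, 0 < m i) (ha : ∀ i, 0 ≤ a i) (hb : ∀ i, 0 ≤ b i)
    (hT : ∀ x, totalRate m a b x ≠ 0) (hk₁ : 0 < k₁) (hk : k₁ ≤ k₂) (hk₂ : k₂ < N) {v : ℝ}
    (h0 : ∑ i ∈ block N 0 N, m i * (b i - a i + v) = 0)
    (hpos : ∀ k, 0 < k → k < N → 0 ≤ ∑ i ∈ block N 0 k, m i * (b i - a i + v))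
    (h1 : ∑ i ∈ block N 0 k₁, m i * (b i - a i + v) = 0)
    (h2 : ∑ i ∈ block N k₂ N, m i * (b i - a i + v) = 0)
    (h : (∃ j ∈ block N 0 k₁, 0 < a j) ∨ ∃ j ∈ block N k₂ N, 0 < b j) :
    ∃ θ β C : ℝ, 0 < θ ∧ 0 < β ∧ 0 ≤ C ∧ ∀ n : ℕ, 1 ≤ n → ∀ R : ℝ, 1 ≤ R →
      ∃ F : (Fin N → ℤ) → ℝ, (∀ y, 0 ≤ F y) ∧ (∀ x : Config N, 1 ≤ F x.1) ∧
        (∀ x : Config N, F x.1 ≤ Real.exp (θ * Real.sqrt (1 + scatter m (block N 0 N) x.1))) ∧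
        ∀ x : Config N, Real.exp (if centroidGap m k₁ k₂ x.1 ≤ R - 1 then
          β / (R * Real.sqrt n) else 0) * jumpMean m a b x F ≤ Real.exp (C / n) * F x.1 := by
  obtain ⟨σ, hσ0, hσ⟩ := exists_le_jumpMean_sq hm ha hb hT hk h
  have hN : 0 < N := by omega
  obtain ⟨c, hc, hcm⟩ : ∃ c : ℝ, 0 < c ∧ ∀ i, c ≤ m i := by
    obtain ⟨i, -, hi⟩ := Finset.exists_min_image Finset.univ m ⟨⟨0, hN⟩, Finset.mem_univ _⟩
    exact ⟨m i, hm i, fun k => hi k (Finset.mem_univ k)⟩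
  set Kb := ∑ i, m i with hKb
  have hmK : ∀ i, m i ≤ Kb := fun i =>
    Finset.single_le_sum (fun j _ => (hm j).le) (Finset.mem_univ i)
  have hKb0 : 0 < Kb := (hm ⟨0, hN⟩).trans_le (hmK _)
  set K := Real.sqrt Kb with hK
  have hK0 : 0 < K := Real.sqrt_pos.2 hKb0
  have hsq : K ^ 2 = Kb := Real.sq_sqrt hKb0.le
  -- Chosen so that `κ` times the spread is at most the root of the moment of inertia, which makes
  -- `U` nonnegative on configurations.
  set κ := Real.sqrt (c / 4) with hκ
  have hκ0 : 0 < κ := Real.sqrt_pos.2 (by positivity)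
  have hκ2 : κ ^ 2 = c / 4 := Real.sq_sqrt (by positivity)
  -- Increments are at most `K` for `f` and `κ` for `κ / (2R) * g`, so those of `U` are at most
  -- `1/√n`.
  set θ := (K + κ)⁻¹ with hθ
  have hθ0 : 0 < θ := by positivity
  -- `β` is the gain `σ` of `g` times the coefficients of `U`; in `C` the first term is the drift of
  -- `f` and the `1` comes from the squared increments.
  refine ⟨θ, θ * κ * σ / 2, θ * Kb / 2 + 1, hθ0, by positivity, by positivity,
    fun n hn R hR => ?_⟩
  have hn0 : (0 : ℝ) < n := by exact_mod_cast hn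
  have hR0 : 0 < R := by linarith
  set r := Real.sqrt n with hr
  have hr0 : 0 < r := Real.sqrt_pos.2 hn0
  have hr2 : r ^ 2 = n := Real.sq_sqrt hn0.le
  set Q := scatter m (block N 0 N) with hQ
  set Z := centroidGap m k₁ k₂ with hZ
  have hQ0 : ∀ y, 0 ≤ Q y := scatter_nonneg hm
  -- The shift by `n` bounds the drift of `f` by a constant over `√n`, hence its share in the drift
  -- of `U` by a constant over `n`.
  let f : (Fin N → ℤ) → ℝ := fun y => Real.sqrt (n + Q y)
  let g : (Fin N → ℤ) → ℝ := fun y => quadCap R (Z y)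
  let U : (Fin N → ℤ) → ℝ := fun y => θ / r * (f y + -(κ / (2 * R)) * g y)
  have hZ0 : ∀ x : Config N, 0 ≤ Z x.1 := centroidGap_nonneg hm hk₁ hk hk₂
  refine ⟨fun y => Real.exp (U y), fun y => (Real.exp_pos _).le, fun x => ?_, fun x => ?_,
    fun x => ?_⟩
  · refine Real.one_le_exp (mul_nonneg (by positivity) ?_)
    have e1 := mul_sq_spread_le_scatter hm hN le_rfl hc hcm x
    have e2 := centroidGap_le hm hk₁ hk hk₂ x
    have e3 := quadCap_le hR0.le (hZ0 x)
    have e4 : κ / (2 * R) * g x.1 ≤ κ * Z x.1 := by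
      refine (mul_le_mul_of_nonneg_left e3 (by positivity)).trans_eq ?_
      field_simp
    have e5 : κ * Z x.1 ≤ f x.1 := by
      refine Real.le_sqrt_of_sq_le ?_
      have e6 : Z x.1 ^ 2 ≤ ((x.1 ⟨N - 1, by omega⟩ : ℝ) - x.1 ⟨0, by omega⟩) ^ 2 :=
        pow_le_pow_left₀ (hZ0 x) e2 2
      have e7 := mul_le_mul_of_nonneg_left e6 hc.le
      rw [mul_pow, hκ2]
      linarith
    linarith
  · refine Real.exp_le_exp.2 ?_
    have e1 : 0 ≤ g x.1 := by
      have e := quadCap_add_ge R 0 (Z x.1)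
      rw [min_eq_left hR0.le, zero_add] at e
      have : quadCap R 0 = 0 := by
        rw [quadCap, max_eq_right (by linarith)]; ring
      simpa [this] using e
    have e2 : f x.1 ≤ r * Real.sqrt (1 + Q x.1) := by
      rw [hr, ← Real.sqrt_mul hn0.le]
      refine Real.sqrt_le_sqrt ?_
      have : (1 : ℝ) ≤ n := by exact_mod_cast hn
      nlinarith [hQ0 x.1]
    have e3 : 0 ≤ κ / (2 * R) * g x.1 := mul_nonneg (by positivity) e1
    calc U x.1 ≤ θ / r * (r * Real.sqrt (1 + Q x.1)) :=
          mul_le_mul_of_nonneg_left (by linarith) (by positivity)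
      _ = θ * Real.sqrt (1 + Q x.1) := by field_simp
  · have hinc : ∀ (i : Fin N) (s : ℤ), s ^ 2 = 1 →
        |U (x.1 + Pi.single i s) - U x.1| ≤ 1 / r := by
      intro i s hs
      have e1 := abs_sqrt_scatter_add_single_sub_le (C := block N 0 N) hm x.1 i hs hn0.le hK0.le
        fun i => (hmK i).trans_eq hsq.symm
      have e2 := abs_quadCap_add_sub_le hR (hZ0 x)
        (abs_centroidGap_add_single_sub_le hm hk x.1 i hs)
      rw [add_sub_cancel] at e2
      have e3 : U (x.1 + Pi.single i s) - U x.1 = θ / r * ((f (x.1 + Pi.single i s) - f x.1) -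
          κ / (2 * R) * (g (x.1 + Pi.single i s) - g x.1)) := by
        simp only [U]; ring
      rw [e3, abs_mul, abs_of_pos (show 0 < θ / r by positivity)]
      have e4 : |κ / (2 * R) * (g (x.1 + Pi.single i s) - g x.1)| ≤ κ := by
        rw [abs_mul, abs_of_pos (show 0 < κ / (2 * R) by positivity)]
        refine (mul_le_mul_of_nonneg_left e2 (by positivity)).trans_eq ?_
        field_simp
      calc θ / r * _ ≤ θ / r * (K + κ) :=
            mul_le_mul_of_nonneg_left ((abs_sub _ _).trans (add_le_add e1 e4)) (by positivity)
        _ = 1 / r := by rw [hθ]; field_simp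
    have hexp := jumpMean_exp_le (f := U) (K := 1 / r) hm ha hb (hT x)
      (by
        rw [div_le_one hr0, hr, Real.one_le_sqrt]
        exact_mod_cast hn)
      (fun i => by rw [sub_single_eq]; exact hinc i (-1) rfl) (fun i => hinc i 1 rfl)
    have hf : jumpMean m a b x f - f x.1 ≤ Kb / (2 * r) := by
      have e1 := jumpMean_sqrt_sub_le hm ha hb (hT x) hQ0 hn0
      have e2 := jumpMean_scatter_sub_le hm ha hb (hT x) hN le_rfl hmK h0 (δ := 0) hpos
      rw [mul_zero, zero_mul, neg_zero, zero_div, zero_add] at e2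
      have e3 : r ≤ Real.sqrt (n + Q x.1) := Real.sqrt_le_sqrt (by linarith [hQ0 x.1])
      calc _ ≤ _ := e1
        _ ≤ Kb / (2 * Real.sqrt (n + Q x.1)) := div_le_div_of_nonneg_right e2 (by positivity)
        _ ≤ Kb / (2 * r) := div_le_div_of_nonneg_left hKb0.le (by positivity) (by linarith)
    -- The tangent term has nonnegative slope times the nonnegative drift of `Z`; the exact square
    -- below `R - 1` contributes `σ`.
    have hg : (if Z x.1 ≤ R - 1 then σ else 0) ≤ jumpMean m a b x g - g x.1 := by
      set I : ℝ := if Z x.1 ≤ R - 1 then 1 else 0 with hI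
      have e1 : ∀ (i : Fin N) (s : ℤ), s ^ 2 = 1 →
          I * (Z (x.1 + Pi.single i s) - Z x.1) ^ 2 + (2 * min (Z x.1) R * Z (x.1 + Pi.single i s) +
            (g x.1 - 2 * min (Z x.1) R * Z x.1)) ≤ g (x.1 + Pi.single i s) := by
        intro i s hs
        have hd := abs_centroidGap_add_single_sub_le hm hk x.1 i hs
        have e := quadCap_add_ge R (Z x.1) (Z (x.1 + Pi.single i s) - Z x.1)
        rw [add_sub_cancel] at e
        by_cases hc : Z x.1 ≤ R - 1
        · have e' := quadCap_add_eq hc hd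
          rw [add_sub_cancel] at e'
          simp only [hI, if_pos hc, g]
          rw [e']
          apply le_of_eq
          ring
        · simp only [hI, if_neg hc, g]
          linarith
      have e2 := jumpMean_mono (m := m) (a := a) (b := b) (x := x) hm ha hb
        (φ := fun y => I * (Z y - Z x.1) ^ 2 + (2 * min (Z x.1) R * Z y +
            (g x.1 - 2 * min (Z x.1) R * Z x.1))) (ψ := g)
        (fun i => by rw [sub_single_eq]; exact e1 i (-1) rfl) (fun i => e1 i 1 rfl)
      rw [jumpMean_add, jumpMean_add, jumpMean_const_mul, jumpMean_const_mul,
        jumpMean_const (hT x)] at e2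
      have e3 := centroidGap_le_jumpMean hm ha hb (hT x) hk₁ hk hk₂ h1 h2
      have e4 : 0 ≤ min (Z x.1) R := le_min (hZ0 x) hR0.le
      have e5 := mul_le_mul_of_nonneg_left e3 e4
      have e6 : (if Z x.1 ≤ R - 1 then σ else 0) ≤
          I * jumpMean m a b x fun y => (Z y - Z x.1) ^ 2 := by
        by_cases hc : Z x.1 ≤ R - 1
        · simp only [hI, if_pos hc, one_mul]; exact hσ x
        · simp only [hI, if_neg hc, zero_mul]; exact le_rfl
      linarith
    set w : ℝ := if Z x.1 ≤ R - 1 then θ * κ * σ / 2 / (R * r) else 0 with hw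
    have hw' : w = θ / r * (κ / (2 * R) * (if Z x.1 ≤ R - 1 then σ else 0)) := by
      rw [hw]; split_ifs
      · field_simp
      · simp
    have hU : jumpMean m a b x U - U x.1 ≤ θ * Kb / 2 / n - w := by
      have e1 : jumpMean m a b x U - U x.1 = θ / r * ((jumpMean m a b x f - f x.1) -
          κ / (2 * R) * (jumpMean m a b x g - g x.1)) := by
        simp only [U]
        rw [jumpMean_const_mul, jumpMean_add, jumpMean_const_mul]
        ring
      have e2 : θ * Kb / 2 / n = θ / r * (Kb / (2 * r)) := by
        rw [← hr2]; field_simp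
      rw [e1, e2, hw', ← mul_sub]
      refine mul_le_mul_of_nonneg_left (sub_le_sub hf ?_) (by positivity)
      exact mul_le_mul_of_nonneg_left hg (by positivity)
    have hrn : (1 / r) ^ 2 = 1 / (n : ℝ) := by rw [div_pow, hr2, one_pow]
    have hfin : 1 + (jumpMean m a b x U - U x.1) + (1 / r) ^ 2 ≤
        Real.exp ((θ * Kb / 2 + 1) / n - w) := by
      have := Real.add_one_le_exp ((θ * Kb / 2 + 1) / n - w)
      rw [hrn]
      rw [add_div] at this ⊢
      linarith
    calc Real.exp w * jumpMean m a b x (fun y => Real.exp (U y))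
        ≤ Real.exp w * (Real.exp (U x.1) * Real.exp ((θ * Kb / 2 + 1) / n - w)) := by
          refine mul_le_mul_of_nonneg_left (hexp.trans ?_) (Real.exp_pos _).le
          exact mul_le_mul_of_nonneg_left hfin (Real.exp_pos _).le
      _ = Real.exp ((θ * Kb / 2 + 1) / n) * Real.exp (U x.1) := by
          rw [← Real.exp_add, ← Real.exp_add, ← Real.exp_add]
          ring_nf

end Count

/-! ### Growth of iterated operators. -/

section Iterates

variable {N : ℕ} {m a b : Fin N → ℝ}

theorem iterate_weightedStep_le_pow {S : Type*} (κ : S → S → ℝ≥0∞) (w F : S → ℝ≥0∞) {c : ℝ≥0∞}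
    (h : ∀ x, weightedStep κ w F x ≤ c * F x) (n : ℕ) (x : S) :
    (weightedStep κ w)^[n] F x ≤ c ^ n * F x := by
  induction n generalizing x with
  | zero => simp
  | succ n ih =>
    rw [Function.iterate_succ_apply']
    calc weightedStep κ w ((weightedStep κ w)^[n] F) x
        ≤ weightedStep κ w (fun y => c ^ n * F y) x := weightedStep_mono κ w ih x
      _ = c ^ n * weightedStep κ w F x := by
          simp only [weightedStep, ← ENNReal.tsum_mul_left]
          exact tsum_congr fun y => by ring
      _ ≤ c ^ n * (c * F x) := by gcongr; exact h x
      _ = c ^ (n + 1) * F x := by ring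

theorem iterate_weightedStep_one_le_add {S : Type*} (κ : S → S → ℝ≥0∞) (F : S → ℝ≥0∞) {C : ℝ≥0∞}
    (hκ : ∀ x, ∑' y, κ x y = 1) (h : ∀ x, weightedStep κ (fun _ => 1) F x ≤ F x + C) (n : ℕ)
    (x : S) : (weightedStep κ fun _ => 1)^[n] F x ≤ F x + n * C := by
  induction n generalizing x with
  | zero => simp
  | succ n ih =>
    rw [Function.iterate_succ_apply']
    calc weightedStep κ (fun _ => 1) ((weightedStep κ fun _ => 1)^[n] F) x
        ≤ weightedStep κ (fun _ => 1) (fun y => F y + n * C) x := weightedStep_mono κ _ ih x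
      _ = weightedStep κ (fun _ => 1) F x + n * C := by
          simp only [weightedStep, one_mul, mul_add]
          rw [ENNReal.tsum_add, ENNReal.tsum_mul_right, hκ, one_mul]
      _ ≤ F x + C + n * C := by gcongr; exact h x
      _ = F x + (n + 1 : ℕ) * C := by push_cast; ring

end Iterates

/-! ### Tail bounds for spreads and for the number of visits. -/

section Tails

variable {N : ℕ} {m a b : Fin N → ℝ}

/-- Markov's inequality for the exponential moment. The factor `n + 1` reflects its additive growth
per step, and `E` normalises it to be at least `1` on the event. -/
theorem exists_spread_tail (hm : ∀ i, 0 < m i) (ha : ∀ i, 0 ≤ a i) (hb : ∀ i, 0 ≤ b i)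
    (hT : ∀ x, totalRate m a b x ≠ 0) {p q : ℕ} (hpq : p < q) (hq : q ≤ N) {v : ℝ}
    (h0 : ∑ i ∈ block N p q, m i * (b i - a i + v) = 0)
    (hpos : ∀ k, p < k → k < q → 0 < ∑ i ∈ block N p k, m i * (b i - a i + v)) (x₀ : Config N) :
    ∃ ρ D : ℝ, 0 < ρ ∧ 0 ≤ D ∧ ∀ {Ω : Type*} [MeasurableSpace Ω] {μ : Measure Ω}
      {X : ℝ≥0 → Ω → Config N}, IsElasticSystem m a b x₀ μ X → ∀ (n : ℕ) (r : ℝ),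
        μ {ω | r < ((atJump (X · ω) n).1 ⟨q - 1, by omega⟩ : ℝ) -
            (atJump (X · ω) n).1 ⟨p, by omega⟩} ≤
          ENNReal.ofReal (D * (n + 1) * Real.exp (-(ρ * r))) := by
  obtain ⟨θ, C, hθ, hC, hF⟩ := exists_exp_scatter_bound hm ha hb hT hpq hq h0 hpos
  obtain ⟨c, hc, hcm⟩ : ∃ c : ℝ, 0 < c ∧ ∀ i, c ≤ m i := by
    obtain ⟨i, -, hi⟩ := Finset.exists_min_image Finset.univ m ⟨⟨p, by omega⟩, Finset.mem_univ _⟩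
    exact ⟨m i, hm i, fun k => hi k (Finset.mem_univ k)⟩
  set κ := Real.sqrt (c / 4) with hκ
  have hκ0 : 0 < κ := Real.sqrt_pos.2 (by positivity)
  have hκ2 : κ ^ 2 = c / 4 := Real.sq_sqrt (by positivity)
  refine ⟨θ * κ, Real.exp (θ * Real.sqrt (1 + scatter m (block N p q) x₀.1)) + C, by positivity,
    by positivity, fun {Ω} _ {μ} {X} hX n r => ?_⟩
  set E := Real.exp (-(θ * κ * r)) with hE
  have hE0 : 0 < E := Real.exp_pos _
  let F : (Fin N → ℤ) → ℝ := fun y =>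
    E * Real.exp (θ * Real.sqrt (1 + scatter m (block N p q) y))
  have hF0 : ∀ y, 0 ≤ F y := fun y => by positivity
  have hstep : ∀ x : Config N, weightedStep (jumpProb m a b) (fun _ => 1)
      (fun y => ENNReal.ofReal (F y.1)) x ≤ ENNReal.ofReal (F x.1) + ENNReal.ofReal (E * C) := by
    intro x
    rw [← ENNReal.ofReal_add (hF0 _) (by positivity)]
    have := weightedStep_le (w := fun _ => 1) (F := F) hm ha hb (fun _ => zero_le_one) hF0 x
      (G := F x.1 + E * C) (by
        rw [one_mul, jumpMean_const_mul, ← mul_add]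
        exact mul_le_mul_of_nonneg_left (hF x) hE0.le)
    simpa using this
  have hmain := measure_le_iterate_weightedStep hm ha hb hT hX n (fun _ => 1)
    (fun y => ENNReal.ofReal (F y.1))
    (B := {ω | r < ((atJump (X · ω) n).1 ⟨q - 1, by omega⟩ : ℝ) -
      (atJump (X · ω) n).1 ⟨p, by omega⟩}) (by
      intro ω hω
      rw [Finset.prod_const_one, one_mul, ENNReal.one_le_ofReal]
      set y := atJump (X · ω) n
      have e1 := mul_sq_spread_le_scatter hm hpq hq hc hcm y
      have hω' : r < (y.1 ⟨q - 1, by omega⟩ : ℝ) - y.1 ⟨p, by omega⟩ := hω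
      set S := (y.1 ⟨q - 1, by omega⟩ : ℝ) - y.1 ⟨p, by omega⟩
      have e2 : κ * S ≤ Real.sqrt (1 + scatter m (block N p q) y.1) := by
        refine Real.le_sqrt_of_sq_le ?_
        rw [mul_pow, hκ2]
        linarith
      simp only [F]
      rw [hE, ← Real.exp_add]
      refine Real.one_le_exp ?_
      have e3 : κ * r ≤ κ * S := mul_le_mul_of_nonneg_left hω'.le hκ0.le
      have e4 := mul_le_mul_of_nonneg_left (e3.trans e2) hθ.le
      linarith)
  refine hmain.trans ((iterate_weightedStep_one_le_add _ _ (fun x => tsum_jumpProb hm ha hb (hT x))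
    hstep n x₀).trans ?_)
  rw [← ENNReal.ofReal_natCast, ← ENNReal.ofReal_mul n.cast_nonneg,
    ← ENNReal.ofReal_add (hF0 _) (by positivity)]
  refine ENNReal.ofReal_le_ofReal ?_
  simp only [F]
  have e1 : 0 < Real.exp (θ * Real.sqrt (1 + scatter m (block N p q) x₀.1)) := Real.exp_pos _
  set G := Real.exp (θ * Real.sqrt (1 + scatter m (block N p q) x₀.1))
  have e2 : 0 ≤ (G * n + C) * E := by positivity
  nlinarith

variable {k₁ k₂ : ℕ}

/-- Chernoff's bound with weight `ξ` per visit: the growth over `n` steps is `exp C`, and the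
initial value is bounded uniformly in `n` and `R`. -/
theorem exists_count_tail (hm : ∀ i, 0 < m i) (ha : ∀ i, 0 ≤ a i) (hb : ∀ i, 0 ≤ b i)
    (hT : ∀ x, totalRate m a b x ≠ 0) (hk₁ : 0 < k₁) (hk : k₁ ≤ k₂) (hk₂ : k₂ < N) {v : ℝ}
    (h0 : ∑ i ∈ block N 0 N, m i * (b i - a i + v) = 0)
    (hpos : ∀ k, 0 < k → k < N → 0 ≤ ∑ i ∈ block N 0 k, m i * (b i - a i + v))
    (h1 : ∑ i ∈ block N 0 k₁, m i * (b i - a i + v) = 0)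
    (h2 : ∑ i ∈ block N k₂ N, m i * (b i - a i + v) = 0)
    (h : (∃ j ∈ block N 0 k₁, 0 < a j) ∨ ∃ j ∈ block N k₂ N, 0 < b j) (x₀ : Config N) :
    ∃ β D : ℝ, 0 < β ∧ 0 ≤ D ∧ ∀ {Ω : Type*} [MeasurableSpace Ω] {μ : Measure Ω}
      {X : ℝ≥0 → Ω → Config N}, IsElasticSystem m a b x₀ μ X → ∀ n : ℕ, 1 ≤ n →
        ∀ R : ℝ, 1 ≤ R → ∀ t : ℝ,
        μ {ω | t < (((Finset.range (n + 1)).filter fun k =>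
            centroidGap m k₁ k₂ (atJump (X · ω) k).1 ≤ R - 1).card : ℝ)} ≤
          ENNReal.ofReal (D * Real.exp (-(β * t / (R * Real.sqrt n)))) := by
  obtain ⟨θ, β, C, hθ, hβ, hC, hF⟩ :=
    exists_count_lyapunov hm ha hb hT hk₁ hk hk₂ h0 hpos h1 h2 h
  refine ⟨β, Real.exp C * Real.exp (β + θ * Real.sqrt (1 + scatter m (block N 0 N) x₀.1)), hβ,
    by positivity, fun {Ω} _ {μ} {X} hX n hn R hR t => ?_⟩
  obtain ⟨F, hF0, hF1, hF2, hF3⟩ := hF n hn R hR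
  have hn1 : (1 : ℝ) ≤ n := by exact_mod_cast hn
  have hr1 : 1 ≤ Real.sqrt n := Real.one_le_sqrt.2 hn1
  set ξ := β / (R * Real.sqrt n) with hξ
  have hRr : 1 ≤ R * Real.sqrt n := one_le_mul_of_one_le_of_one_le hR hr1
  have hξ0 : 0 < ξ := by positivity
  have hξβ : ξ ≤ β := div_le_self hβ.le hRr
  -- The weights cover the times below `n` and the count includes `n`; the summand `β ≥ ξ` makes up
  -- for this visit.
  set E := Real.exp (β - ξ * t) with hE
  have hE0 : 0 < E := Real.exp_pos _
  let w : (Fin N → ℤ) → ℝ := fun y =>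
    Real.exp (if centroidGap m k₁ k₂ y ≤ R - 1 then ξ else 0)
  have hw0 : ∀ y, 0 ≤ w y := fun y => (Real.exp_pos _).le
  have hstep : ∀ x : Config N, weightedStep (jumpProb m a b) (fun y => ENNReal.ofReal (w y.1))
      (fun y => ENNReal.ofReal (E * F y.1)) x ≤
        ENNReal.ofReal (Real.exp (C / n)) * ENNReal.ofReal (E * F x.1) := by
    intro x
    rw [← ENNReal.ofReal_mul (Real.exp_pos _).le]
    refine weightedStep_le (w := w) (F := fun y => E * F y) hm ha hb hw0
      (fun y => mul_nonneg hE0.le (hF0 y)) x ?_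
    rw [jumpMean_const_mul]
    have := mul_le_mul_of_nonneg_left (hF3 x) hE0.le
    simp only [w]
    linarith
  have hmain := measure_le_iterate_weightedStep hm ha hb hT hX n (fun y => ENNReal.ofReal (w y.1))
    (fun y => ENNReal.ofReal (E * F y.1))
    (B := {ω | t < (((Finset.range (n + 1)).filter fun k =>
            centroidGap m k₁ k₂ (atJump (X · ω) k).1 ≤ R - 1).card : ℝ)}) (by
      intro ω hω
      rw [← ENNReal.ofReal_prod_of_nonneg fun k _ => hw0 _,
        ← ENNReal.ofReal_mul (Finset.prod_nonneg fun k _ => hw0 _), ENNReal.one_le_ofReal]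
      have e1 : ∏ k ∈ Finset.range n, w (atJump (X · ω) k).1 =
          Real.exp (((Finset.range n).filter fun k =>
            centroidGap m k₁ k₂ (atJump (X · ω) k).1 ≤ R - 1).card * ξ) := by
        simp only [w]
        rw [← Real.exp_sum, ← Finset.sum_filter, Finset.sum_const, nsmul_eq_mul]
      have e2 : (((Finset.range (n + 1)).filter fun k =>
            centroidGap m k₁ k₂ (atJump (X · ω) k).1 ≤ R - 1).card : ℝ) ≤
          ((Finset.range n).filter fun k =>
            centroidGap m k₁ k₂ (atJump (X · ω) k).1 ≤ R - 1).card + 1 := by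
        rw [Finset.range_add_one, Finset.filter_insert]
        split_ifs
        · exact_mod_cast Finset.card_insert_le _ _
        · exact_mod_cast Nat.le_succ _
      have hω' : t < (((Finset.range (n + 1)).filter fun k =>
            centroidGap m k₁ k₂ (atJump (X · ω) k).1 ≤ R - 1).card : ℝ) := hω
      rw [e1, ← mul_assoc, hE, ← Real.exp_add]
      refine one_le_mul_of_one_le_of_one_le (Real.one_le_exp ?_) (hF1 _)
      have e3 := mul_le_mul_of_nonneg_right (hω'.le.trans e2) hξ0.le
      linarith)
  refine hmain.trans ((iterate_weightedStep_le_pow _ _ _ hstep n x₀).trans ?_)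
  rw [← ENNReal.ofReal_pow (Real.exp_pos _).le, ← Real.exp_nat_mul,
    mul_div_cancel₀ C (by positivity : (n : ℝ) ≠ 0), ← ENNReal.ofReal_mul (Real.exp_pos _).le]
  refine ENNReal.ofReal_le_ofReal ?_
  rw [mul_assoc]
  refine mul_le_mul_of_nonneg_left ?_ (Real.exp_pos _).le
  calc E * F x₀.1 ≤ E * Real.exp (θ * Real.sqrt (1 + scatter m (block N 0 N) x₀.1)) :=
        mul_le_mul_of_nonneg_left (hF2 x₀) hE0.le
    _ = _ := by
        rw [hE, hξ, ← Real.exp_add, ← Real.exp_add]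
        congr 1
        ring

end Tails

/-! ### The least concave majorant through affine majorants. -/

section Majorant

variable {N : ℕ} {m a b : Fin N → ℝ}

theorem cumMass_eq (m : Fin N → ℝ) (k : ℕ) : cumMass m k = ∑ i ∈ block N 0 k, m i := by
  rw [cumMass, block, Finset.sum_filter]
  simp

theorem potential_eq (m a b : Fin N → ℝ) (k : ℕ) :
    potential m a b k = -∑ i ∈ block N 0 k, m i * (b i - a i) := by
  rw [potential, block, Finset.sum_filter]
  simp

theorem sum_block_eq_sub (f : Fin N → ℝ) {p q : ℕ} (hpq : p ≤ q) :
    ∑ i ∈ block N p q, f i = ∑ i ∈ block N 0 q, f i - ∑ i ∈ block N 0 p, f i := by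
  classical
  rw [eq_sub_iff_add_eq, ← Finset.sum_union]
  · congr 1
    ext i
    simp only [Finset.mem_union, mem_block]
    omega
  · refine Finset.disjoint_left.2 fun i h h' => ?_
    rw [mem_block] at h h'
    omega

theorem sum_block_zero_eq (v : ℝ) (k : ℕ) : ∑ i ∈ block N 0 k, m i * (b i - a i + v) =
    v * cumMass m k - potential m a b k := by
  simp only [mul_add, Finset.sum_add_distrib, cumMass_eq, potential_eq, ← Finset.sum_mul]
  ring

theorem cumMass_zero : cumMass m 0 = 0 := by simp [cumMass]

theorem potential_zero : potential m a b 0 = 0 := by simp [potential]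

theorem cumMass_lt (hm : ∀ i, 0 < m i) {k l : ℕ} (hkl : k < l) (hl : l ≤ N) :
    cumMass m k < cumMass m l := by
  have h := sum_block_eq_sub m hkl.le
  have := sum_mass_pos hm (block_nonempty hkl hl)
  rw [cumMass_eq, cumMass_eq]
  linarith

theorem isConcaveMajorant_affine {α β : ℝ}
    (h : ∀ k ≤ N, potential m a b k ≤ α + β * cumMass m k) :
    IsConcaveMajorant m a b fun s => α + β * s := by
  refine ⟨by fun_prop, ⟨convex_Icc _ _, ?_⟩, h⟩
  intro x _ y _ s t _ _ hst
  have : s * (α + β * x) + t * (α + β * y) = (s + t) * α + β * (s * x + t * y) := by ring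
  simp only [smul_eq_mul]
  rw [this, hst, one_mul]

theorem leastConcaveMajorant_le {u : ℝ → ℝ} (hu : IsConcaveMajorant m a b u) {k : ℕ}
    (hk : k ≤ N) : leastConcaveMajorant m a b (cumMass m k) ≤ u (cumMass m k) := by
  refine ciInf_le ⟨potential m a b k, ?_⟩ (⟨u, hu⟩ : {u : ℝ → ℝ // IsConcaveMajorant m a b u})
  rintro _ ⟨w, rfl⟩
  exact w.2.2.2 k hk

/-- An affine majorant bounds the least concave one from above, so a point on the line is squeezed
between the two. -/
theorem mem_boundarySet_of_affine {α β : ℝ}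
    (h : ∀ k ≤ N, potential m a b k ≤ α + β * cumMass m k) {k : ℕ} (hk : k ≤ N)
    (he : potential m a b k = α + β * cumMass m k) : k ∈ boundarySet m a b := by
  have hu := isConcaveMajorant_affine h
  refine ⟨hk, le_antisymm ?_ ((leastConcaveMajorant_le hu hk).trans_eq he.symm)⟩
  have : Nonempty {u : ℝ → ℝ // IsConcaveMajorant m a b u} := ⟨⟨_, hu⟩⟩
  exact le_ciInf fun w => w.2.2.2 k hk

/-- A line through the origin that is steep enough majorises all points. -/
theorem zero_mem_boundarySet (hm : ∀ i, 0 < m i) : 0 ∈ boundarySet m a b := by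
  refine mem_boundarySet_of_affine (α := 0)
    (β := ∑ k ∈ Finset.range (N + 1), |potential m a b k| / cumMass m k) ?_ (Nat.zero_le _) ?_
  · intro k hk
    have hnn : ∀ l ∈ Finset.range (N + 1), 0 ≤ |potential m a b l| / cumMass m l := fun l _ =>
      div_nonneg (abs_nonneg _) (by
        rw [cumMass_eq]; exact Finset.sum_nonneg fun i _ => (hm i).le)
    rcases Nat.eq_zero_or_pos k with rfl | h0
    · simp [potential_zero, cumMass_zero]
    · have hM : 0 < cumMass m k := by
        have := cumMass_lt hm h0 hk
        rwa [cumMass_zero] at this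
      have h1 := Finset.single_le_sum hnn (Finset.mem_range.2 (Nat.lt_succ_of_le hk))
      rw [zero_add, ← div_le_iff₀ hM]
      exact (div_le_div_of_nonneg_right (le_abs_self _) hM.le).trans h1
  · simp [potential_zero, cumMass_zero]

theorem last_mem_boundarySet (hm : ∀ i, 0 < m i) : N ∈ boundarySet m a b := by
  -- Now a line descending steeply to the last point.
  set L := ∑ k ∈ Finset.range (N + 1),
    |potential m a b k - potential m a b N| / (cumMass m N - cumMass m k) with hL
  refine mem_boundarySet_of_affine (α := potential m a b N + L * cumMass m N) (β := -L) ?_ le_rfl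
    (by ring)
  intro k hk
  have hle : ∀ l ≤ N, cumMass m l ≤ cumMass m N := fun l hl => by
    rcases hl.eq_or_lt with rfl | h
    · exact le_rfl
    · exact (cumMass_lt hm h le_rfl).le
  have hnn : ∀ l ∈ Finset.range (N + 1),
      0 ≤ |potential m a b l - potential m a b N| / (cumMass m N - cumMass m l) := fun l hl =>
    div_nonneg (abs_nonneg _) (sub_nonneg.2 (hle l (Nat.lt_succ_iff.1 (Finset.mem_range.1 hl))))
  rcases hk.eq_or_lt with rfl | h0
  · linarith
  · have hM : 0 < cumMass m N - cumMass m k := sub_pos.2 (cumMass_lt hm h0 le_rfl)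
    have h1 := Finset.single_le_sum hnn (Finset.mem_range.2 (Nat.lt_succ_of_le hk))
    have h2 := (div_le_div_of_nonneg_right (le_abs_self (potential m a b k - potential m a b N))
      hM.le).trans h1
    rw [← hL, div_le_iff₀ hM] at h2
    linarith

theorem finite_boundarySet : (boundarySet m a b).Finite :=
  (Set.finite_Iic N).subset fun _ hk => hk.1

end Majorant

/-! ### Boundary indices, equal slopes and the extreme clouds. -/

section Clouds

variable {N : ℕ} {m a b : Fin N → ℝ}

/-- `numClouds` is a truncated difference; since it is positive, there are exactly `numClouds + 1`
boundary indices and `Nat.nth` does not take its default value. -/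
theorem boundaryIndex_mem {j : ℕ} (hν : 2 ≤ numClouds m a b) (hj : j ≤ numClouds m a b) :
    boundaryIndex m a b j ∈ boundarySet m a b := by
  refine Nat.nth_mem j fun hf => ?_
  have : hf.toFinset.card = (boundarySet m a b).ncard := (Set.ncard_eq_toFinset_card _ hf).symm
  unfold numClouds at hν hj
  omega

theorem boundaryIndex_lt {i j : ℕ} (hν : 2 ≤ numClouds m a b) (hij : i < j)
    (hj : j ≤ numClouds m a b) : boundaryIndex m a b i < boundaryIndex m a b j := by
  refine Nat.nth_lt_nth' hij fun hf => ?_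
  have : hf.toFinset.card = (boundarySet m a b).ncard := (Set.ncard_eq_toFinset_card _ hf).symm
  unfold numClouds at hν hj
  omega

theorem exists_boundaryIndex_eq (hν : 2 ≤ numClouds m a b) {k : ℕ} (hk : k ∈ boundarySet m a b) :
    ∃ j ≤ numClouds m a b, boundaryIndex m a b j = k := by
  have hf : (Set.ofPred (· ∈ boundarySet m a b)).Finite := finite_boundarySet
  obtain ⟨j, hj, he⟩ := Nat.exists_lt_card_finite_nth_eq hf hk
  have : hf.toFinset.card = (boundarySet m a b).ncard := (Set.ncard_eq_toFinset_card _ hf).symm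
  refine ⟨j, ?_, he⟩
  unfold numClouds at hν ⊢
  omega

theorem boundaryIndex_zero (hm : ∀ i, 0 < m i) : boundaryIndex m a b 0 = 0 :=
  Nat.nth_zero_of_zero (zero_mem_boundarySet hm)

theorem boundaryIndex_numClouds (hm : ∀ i, 0 < m i) (hν : 2 ≤ numClouds m a b) :
    boundaryIndex m a b (numClouds m a b) = N := by
  obtain ⟨j, hj, he⟩ := exists_boundaryIndex_eq hν (last_mem_boundarySet (a := a) (b := b) hm)
  rcases hj.eq_or_lt with rfl | h
  · exact he
  · have h1 := boundaryIndex_lt hν h le_rfl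
    have h2 := (boundaryIndex_mem hν (le_refl (numClouds m a b))).1
    omega

theorem notMem_boundarySet_of_between {j k : ℕ} (h1 : boundaryIndex m a b j < k)
    (h2 : k < boundaryIndex m a b (j + 1)) : k ∉ boundarySet m a b := by
  intro hk
  have := Nat.le_nth_of_lt_nth_succ h2 hk
  exact absurd h1 (not_lt.2 this)

/-- If all slopes are equal, all boundary points lie on one line through the origin. -/
theorem potential_eq_of_mem_boundarySet (hm : ∀ i, 0 < m i) (hν : 2 ≤ numClouds m a b)
    (heq : EqualSlopes m a b) {k : ℕ} (hk : k ∈ boundarySet m a b) :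
    potential m a b k = cloudSlope m a b 0 * cumMass m k := by
  have key : ∀ j ≤ numClouds m a b, potential m a b (boundaryIndex m a b j) =
      cloudSlope m a b 0 * cumMass m (boundaryIndex m a b j) := by
    intro j hj
    induction j with
    | zero => simp [boundaryIndex_zero hm, potential_zero, cumMass_zero]
    | succ j ih =>
      have h1 := ih (by omega)
      have h2 := heq j hj
      have h3 := cumMass_lt hm (boundaryIndex_lt hν (Nat.lt_succ_self j) hj)
        (boundaryIndex_mem hν hj).1
      rw [cloudSlope, div_eq_iff (sub_pos.2 h3).ne'] at h2
      linarith
  obtain ⟨j, hj, rfl⟩ := exists_boundaryIndex_eq hν hk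
  exact key j hj

/-- If all slopes are equal, the least concave majorant is linear. -/
theorem potential_le (hm : ∀ i, 0 < m i) (hν : 2 ≤ numClouds m a b) (heq : EqualSlopes m a b)
    {k : ℕ} (hk : k ≤ N) : potential m a b k ≤ cloudSlope m a b 0 * cumMass m k := by
  set v := cloudSlope m a b 0
  -- Lower a line of slope `v` until it touches the points. The contact index is a boundary index,
  -- so the line is the one through the origin.
  obtain ⟨l, hl, hmax⟩ := Finset.exists_max_image (Finset.range (N + 1))
    (fun k => potential m a b k - v * cumMass m k) ⟨0, by simp⟩
  have hlN : l ≤ N := Nat.lt_succ_iff.1 (Finset.mem_range.1 hl)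
  have hmem : l ∈ boundarySet m a b :=
    mem_boundarySet_of_affine (α := potential m a b l - v * cumMass m l) (β := v)
      (fun k hk => by linarith [hmax k (Finset.mem_range.2 (Nat.lt_succ_of_le hk))]) hlN (by ring)
  have h1 := potential_eq_of_mem_boundarySet hm hν heq hmem
  have h2 := hmax k (Finset.mem_range.2 (Nat.lt_succ_of_le hk))
  linarith

theorem potential_lt (hm : ∀ i, 0 < m i) (hν : 2 ≤ numClouds m a b) (heq : EqualSlopes m a b)
    {k : ℕ} (hk : k ≤ N) (hkV : k ∉ boundarySet m a b) :
    potential m a b k < cloudSlope m a b 0 * cumMass m k := by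
  refine lt_of_le_of_ne (potential_le hm hν heq hk) fun h => hkV ?_
  exact mem_boundarySet_of_affine (α := 0) (β := cloudSlope m a b 0)
    (fun l hl => by linarith [potential_le hm hν heq hl]) hk (by linarith)

/-- The two extreme clouds, and the partial sums of the centred drifts. -/
theorem exists_extreme_blocks (hm : ∀ i, 0 < m i) (ha : ∀ i, 0 ≤ a i) (hb : ∀ i, 0 ≤ b i)
    (hnd : NonDegenerate m a b) (hν : 2 ≤ numClouds m a b) (heq : EqualSlopes m a b) :
    ∃ (k₁ k₂ : ℕ) (v : ℝ), 0 < k₁ ∧ k₁ ≤ k₂ ∧ k₂ < N ∧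
      cloud m a b 0 = block N 0 k₁ ∧ cloud m a b (numClouds m a b - 1) = block N k₂ N ∧
      ∑ i ∈ block N 0 N, m i * (b i - a i + v) = 0 ∧
      (∀ k, 0 < k → k < N → 0 ≤ ∑ i ∈ block N 0 k, m i * (b i - a i + v)) ∧
      ∑ i ∈ block N 0 k₁, m i * (b i - a i + v) = 0 ∧
      ∑ i ∈ block N k₂ N, m i * (b i - a i + v) = 0 ∧
      (∀ k, 0 < k → k < k₁ → 0 < ∑ i ∈ block N 0 k, m i * (b i - a i + v)) ∧
      (∀ k, k₂ < k → k < N → 0 < ∑ i ∈ block N k₂ k, m i * (b i - a i + v)) ∧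
      ((∃ j ∈ block N 0 k₁, 0 < a j) ∨ ∃ j ∈ block N k₂ N, 0 < b j) := by
  set v := cloudSlope m a b 0 with hv
  set ν := numClouds m a b with hνdef
  have hk0 := boundaryIndex_zero (a := a) (b := b) hm
  have hkν : boundaryIndex m a b ν = N := boundaryIndex_numClouds hm hν
  have hm1 := boundaryIndex_mem hν (show 1 ≤ ν by omega)
  have hm2 := boundaryIndex_mem hν (show ν - 1 ≤ ν by omega)
  have hlt0 := boundaryIndex_lt hν zero_lt_one (show 1 ≤ ν by omega)
  have hltν := boundaryIndex_lt hν (show ν - 1 < ν by omega) le_rfl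
  have hle : boundaryIndex m a b 1 ≤ boundaryIndex m a b (ν - 1) := by
    rcases (show 1 ≤ ν - 1 by omega).eq_or_lt with h | h
    · rw [← h]
    · exact (boundaryIndex_lt hν h (by omega)).le
  have hsucc : ν - 1 + 1 = ν := by omega
  have hbtw0 := fun k => notMem_boundarySet_of_between (m := m) (a := a) (b := b) (j := 0)
    (k := k)
  have hbtwν := fun k => notMem_boundarySet_of_between (m := m) (a := a) (b := b)
    (j := ν - 1) (k := k)
  rw [hk0] at hlt0 hbtw0
  rw [zero_add] at hbtw0
  rw [hsucc, hkν] at hbtwν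
  rw [hkν] at hltν
  have hc0 : cloud m a b 0 = block N 0 (boundaryIndex m a b 1) := by
    ext i
    simp only [cloud, mem_ofPred_eq, hk0, zero_add, Finset.mem_coe, mem_block]
  have hcν : cloud m a b (ν - 1) = block N (boundaryIndex m a b (ν - 1)) N := by
    ext i
    simp only [cloud, mem_ofPred_eq, hsucc, hkν, Finset.mem_coe, mem_block]
  generalize boundaryIndex m a b 1 = k₁ at *
  generalize boundaryIndex m a b (ν - 1) = k₂ at *
  have hE : ∀ k ∈ boundarySet m a b, ∑ i ∈ block N 0 k, m i * (b i - a i + v) = 0 := fun k hk => by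
    rw [sum_block_zero_eq, potential_eq_of_mem_boundarySet hm hν heq hk, sub_self]
  have hP : ∀ k ≤ N, k ∉ boundarySet m a b → 0 < ∑ i ∈ block N 0 k, m i * (b i - a i + v) :=
    fun k hk hkV => by
      rw [sum_block_zero_eq, sub_pos]
      exact potential_lt hm hν heq hk hkV
  have h1 := hE k₁ hm1
  have h2 : ∑ i ∈ block N k₂ N, m i * (b i - a i + v) = 0 := by
    rw [sum_block_eq_sub _ hltν.le, hE _ (last_mem_boundarySet hm), hE _ hm2, sub_zero]
  refine ⟨k₁, k₂, v, hlt0, hle, hltν, hc0, hcν, hE N (last_mem_boundarySet hm), fun k _ hk => ?_,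
    h1, h2, fun k hk0 hk => hP k (by have := hm1.1; omega) (hbtw0 k hk0 hk), fun k hk2 hk => ?_, ?_⟩
  · rw [sum_block_zero_eq, sub_nonneg]
    exact potential_le hm hν heq hk.le
  · rw [sum_block_eq_sub _ hk2.le, hE _ hm2, sub_zero]
    exact hP k hk.le (hbtwν k hk2 hk)
  -- Otherwise the first cloud has only right impulses, at least one, and the last has only left
  -- ones. Balance in the first forces `v < 0`, in the last `v ≥ 0`.
  · by_contra! hcon
    obtain ⟨hA, hB⟩ := hcon
    have hA' : ∀ j ∈ block N 0 k₁, a j = 0 := fun j hj => le_antisymm (hA j hj) (ha j)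
    have hB' : ∀ j ∈ block N k₂ N, b j = 0 := fun j hj => le_antisymm (hB j hj) (hb j)
    obtain ⟨j, hj, hbj⟩ : ∃ j ∈ block N 0 k₁, 0 < b j := by
      have h := hnd 0 (by omega)
      obtain ⟨j, -, hj⟩ := Finset.exists_lt_of_sum_lt (s := Finset.univ) (f := fun _ => (0 : ℝ))
        (by simpa using h)
      rw [hc0] at hj
      split_ifs at hj with hmem
      · have hmem' : j ∈ block N 0 k₁ := hmem
        rw [hA' j hmem', zero_add] at hj
        exact ⟨j, hmem', hj⟩
      · exact absurd hj (lt_irrefl _)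
    rcases le_or_gt 0 v with h | h
    · have : 0 < ∑ i ∈ block N 0 k₁, m i * (b i - a i + v) := by
        refine Finset.sum_pos' (fun i hi => mul_nonneg (hm i).le ?_) ⟨j, hj, mul_pos (hm j) ?_⟩
        · rw [hA' i hi]; linarith [hb i]
        · rw [hA' j hj]; linarith
      exact this.ne' h1
    · have : ∑ i ∈ block N k₂ N, m i * (b i - a i + v) < 0 := by
        refine Finset.sum_neg (fun i hi => mul_neg_of_pos_of_neg (hm i) ?_)
          (block_nonempty hltν le_rfl)
        rw [hB' i hi]; linarith [ha i]
      exact this.ne h2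

theorem extremeGap_eq {k₁ k₂ : ℕ} (hk₁ : 0 < k₁) (hk : k₁ ≤ k₂) (hk₂ : k₂ < N)
    (hc : cloud m a b 0 = block N 0 k₁)
    (hc' : cloud m a b (numClouds m a b - 1) = block N k₂ N) (x : Config N) :
    extremeGap m a b x = x.1 ⟨k₂, hk₂⟩ - x.1 ⟨k₁ - 1, by omega⟩ := by
  have h1 : IsLeast (x.1 '' block N k₂ N) (x.1 ⟨k₂, hk₂⟩) := by
    refine ⟨⟨_, mem_block.2 ⟨le_rfl, hk₂⟩, rfl⟩, ?_⟩
    rintro _ ⟨i, hi, rfl⟩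
    exact x.2 (Fin.le_def.2 (mem_block.1 hi).1)
  have h2 : IsGreatest (x.1 '' block N 0 k₁) (x.1 ⟨k₁ - 1, by omega⟩) := by
    refine ⟨⟨_, mem_block.2 ⟨Nat.zero_le _, by simp only; omega⟩, rfl⟩, ?_⟩
    rintro _ ⟨i, hi, rfl⟩
    have := (mem_block.1 hi).2
    exact x.2 (Fin.le_def.2 (by simp only; omega))
  rw [extremeGap, hc, hc', h1.csInf_eq, h2.csSup_eq]

end Clouds

/-! ### Asymptotic comparison and union bounds. -/

section Final

/-- A stretched exponential of larger exponent beats a polynomial factor. -/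
theorem eventually_mul_sq_mul_exp_le {ε s c : ℝ} (hε : 0 < ε) (hs : ε < s) (hc : 0 < c) (D : ℝ) :
    ∀ᶠ n : ℕ in atTop, D * ((n : ℝ) + 1) ^ 2 * Real.exp (-(c * (n : ℝ) ^ s)) ≤
      Real.exp (-(n : ℝ) ^ ε) / 3 := by
  have hu : Tendsto (fun n : ℕ => (n : ℝ) ^ ε) atTop atTop :=
    (tendsto_rpow_atTop hε).comp tendsto_natCast_atTop_atTop
  have hw : Tendsto (fun n : ℕ => (n : ℝ) ^ (s - ε)) atTop atTop :=
    (tendsto_rpow_atTop (sub_pos.2 hs)).comp tendsto_natCast_atTop_atTop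
  have hz : Tendsto (fun n : ℕ => 12 * |D| * (((n : ℝ) ^ ε) ^ (2 / ε) *
      Real.exp (-1 * (n : ℝ) ^ ε))) atTop (nhds 0) := by
    have := ((tendsto_rpow_mul_exp_neg_mul_atTop_nhds_zero (2 / ε) 1 one_pos).comp hu).const_mul
      (12 * |D|)
    simpa using this
  -- Eventually `c n^s ≥ 2 n^ε`: one factor `exp (-n^ε)` is kept, the other absorbs the polynomial
  -- and the constant.
  filter_upwards [hw.eventually_ge_atTop (2 / c), hz.eventually_le_const one_pos,
    eventually_ge_atTop 1] with n h1 h2 h3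
  have hn1 : (1 : ℝ) ≤ n := by exact_mod_cast h3
  have hn0 : (0 : ℝ) < n := by linarith
  have e1 : ((n : ℝ) ^ ε) ^ (2 / ε) = (n : ℝ) ^ 2 := by
    rw [← Real.rpow_mul hn0.le, mul_div_cancel₀ _ hε.ne', Real.rpow_two]
  rw [e1] at h2
  set u := (n : ℝ) ^ ε with hudef
  have hu0 : 0 < u := Real.rpow_pos_of_pos hn0 _
  have e2 : (n : ℝ) ^ s = (n : ℝ) ^ (s - ε) * u := by
    rw [hudef, ← Real.rpow_add hn0]; ring_nf
  have e3 : 2 * u ≤ c * (n : ℝ) ^ s := by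
    rw [div_le_iff₀ hc] at h1
    rw [e2]
    nlinarith
  have e4 : ((n : ℝ) + 1) ^ 2 ≤ 4 * (n : ℝ) ^ 2 := by nlinarith
  calc D * ((n : ℝ) + 1) ^ 2 * Real.exp (-(c * (n : ℝ) ^ s))
      ≤ |D| * (4 * (n : ℝ) ^ 2) * Real.exp (-(2 * u)) := by
        gcongr
        exact le_abs_self D
    _ = (12 * |D| * ((n : ℝ) ^ 2 * Real.exp (-1 * u))) * (Real.exp (-u) / 3) := by
        rw [show -(2 * u) = -1 * u + -u by ring, Real.exp_add]; ring
    _ ≤ 1 * (Real.exp (-u) / 3) := mul_le_mul_of_nonneg_right h2 (by positivity)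
    _ = Real.exp (-u) / 3 := one_mul _

/-- The exponent of the visit bound at `R = 3 n^γ + 1 ≤ 4 n^γ`. -/
theorem rpow_le_div_mul_sqrt {γ ε : ℝ} (hγ : 0 < γ) {n : ℕ} (hn : 1 ≤ n) :
    (n : ℝ) ^ (5 * ε) / 4 ≤
      (n : ℝ) ^ (1 / 2 + γ + 5 * ε) / ((3 * (n : ℝ) ^ γ + 1) * Real.sqrt n) := by
  have hn1 : (1 : ℝ) ≤ n := by exact_mod_cast hn
  have hn0 : (0 : ℝ) < n := by linarith
  have h1 : 1 ≤ (n : ℝ) ^ γ := Real.one_le_rpow hn1 hγ.le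
  have h2 : 0 < Real.sqrt n := Real.sqrt_pos.2 hn0
  have h3 : 0 < (n : ℝ) ^ (5 * ε) := Real.rpow_pos_of_pos hn0 _
  rw [Real.rpow_add hn0, Real.rpow_add hn0, ← Real.sqrt_eq_rpow, le_div_iff₀ (by positivity)]
  have h4 : 0 ≤ (n : ℝ) ^ (5 * ε) * Real.sqrt n * ((n : ℝ) ^ γ - 1) :=
    mul_nonneg (by positivity) (by linarith)
  linarith

variable {N : ℕ} {m a b : Fin N → ℝ} {Ω : Type*} {X : ℝ≥0 → Ω → Config N}

/-- If the extreme clouds are spread out by at most `r`, then a small gap forces their centres of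
mass to be close. -/
theorem smallGapCount_le {k₁ k₂ : ℕ} (hm : ∀ i, 0 < m i) (hk₁ : 0 < k₁) (hk : k₁ ≤ k₂)
    (hk₂ : k₂ < N) (hc : cloud m a b 0 = block N 0 k₁)
    (hc' : cloud m a b (numClouds m a b - 1) = block N k₂ N) (n : ℕ) (r : ℝ) (ω : Ω)
    (h1 : ∀ k ∈ Finset.range (n + 1), ((atJump (X · ω) k).1 ⟨k₁ - 1, by omega⟩ : ℝ) -
      (atJump (X · ω) k).1 ⟨0, by omega⟩ ≤ r)
    (h2 : ∀ k ∈ Finset.range (n + 1), ((atJump (X · ω) k).1 ⟨N - 1, by omega⟩ : ℝ) -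
      (atJump (X · ω) k).1 ⟨k₂, hk₂⟩ ≤ r) :
    smallGapCount m a b (X · ω) n r ≤ ((Finset.range (n + 1)).filter fun k =>
      centroidGap m k₁ k₂ (atJump (X · ω) k).1 ≤ 3 * r + 1 - 1).card := by
  classical
  rw [smallGapCount, Finset.card_filter]
  refine Finset.sum_le_sum fun k hkn => ?_
  by_cases hL : (extremeGap m a b (atJump (X · ω) k) : ℝ) ≤ r
  · rw [if_pos hL, if_pos]
    -- The distance of the outermost particles is the gap plus the two spreads, hence at most `3r`.
    have h3 := centroidGap_le hm hk₁ hk hk₂ (atJump (X · ω) k)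
    rw [extremeGap_eq hk₁ hk hk₂ hc hc'] at hL
    push_cast at hL
    linarith [h1 k hkn, h2 k hkn]
  · rw [if_neg hL]
    exact Nat.zero_le _

theorem measure_exists_lt_le [MeasurableSpace Ω] {μ : Measure Ω} {D e : ℝ} (hD : 0 ≤ D) (he : 0 ≤ e)
    (P : ℕ → Ω → Prop) (hP : ∀ k, μ {ω | P k ω} ≤ ENNReal.ofReal (D * (k + 1) * e)) (n : ℕ) :
    μ {ω | ∃ k ∈ Finset.range (n + 1), P k ω} ≤
      ENNReal.ofReal (D * ((n : ℝ) + 1) ^ 2 * e) := by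
  have hset : {ω | ∃ k ∈ Finset.range (n + 1), P k ω} =
      ⋃ k ∈ Finset.range (n + 1), {ω | P k ω} := by
    ext ω; simp
  rw [hset]
  calc μ (⋃ k ∈ Finset.range (n + 1), {ω | P k ω})
      ≤ ∑ k ∈ Finset.range (n + 1), μ {ω | P k ω} := measure_biUnion_finset_le _ _
    _ ≤ ∑ _k ∈ Finset.range (n + 1), ENNReal.ofReal (D * ((n : ℝ) + 1) * e) := by
        refine Finset.sum_le_sum fun k hk => (hP k).trans (ENNReal.ofReal_le_ofReal ?_)
        have : (k : ℝ) ≤ n := by exact_mod_cast Nat.lt_succ_iff.1 (Finset.mem_range.1 hk)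
        gcongr
    _ = ENNReal.ofReal (D * ((n : ℝ) + 1) ^ 2 * e) := by
        rw [Finset.sum_const, Finset.card_range, nsmul_eq_mul, ← ENNReal.ofReal_natCast,
          ← ENNReal.ofReal_mul (by positivity)]
        push_cast
        ring_nf

end Final

end ElasticParticles

open ElasticParticles
theorem proposition2 (γ : ℝ) (hγ : γ ∈ Ioo (0 : ℝ) (1 / 2)) :
    ∃ ε₀ : ℝ, 0 < ε₀ ∧
      ∀ (N : ℕ) (m a b : Fin N → ℝ), (∀ i, 0 < m i) → (∀ i, 0 ≤ a i) → (∀ i, 0 ≤ b i) →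
        NonDegenerate m a b → 2 ≤ numClouds m a b → EqualSlopes m a b →
        ∀ (x₀ : Config N), ∀ ε ∈ Ioo (0 : ℝ) ε₀, ∀ᶠ n : ℕ in atTop,
          ∀ (Ω : Type*) [MeasurableSpace Ω] (μ : Measure Ω) (X : ℝ≥0 → Ω → Config N),
            IsElasticSystem m a b x₀ μ X →
            μ {ω | (n : ℝ) ^ (1 / 2 + γ + 5 * ε) <
                (smallGapCount m a b (X · ω) n ((n : ℝ) ^ γ) : ℝ)} ≤
              ENNReal.ofReal (Real.exp (-(n : ℝ) ^ ε)) := by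
  -- `ε < γ` lets `exp (-ρ n^γ)` from the spread bounds beat `exp (-n^ε)`.
  refine ⟨γ, hγ.1, fun N m a b hm ha hb hnd hν heq x₀ ε hε => ?_⟩
  obtain ⟨k₁, k₂, v, hk₁, hk, hk₂, hc, hc', h0, hpos, h1, h2, hpos1, hpos2, hact⟩ :=
    exists_extreme_blocks hm ha hb hnd hν heq
  have hT : ∀ x, totalRate m a b x ≠ 0 := fun x => by
    refine (totalRate_pos hm ha hb ?_ x).ne'
    rcases hact with ⟨j, -, hj⟩ | ⟨j, -, hj⟩
    · exact ⟨j, by linarith [hb j]⟩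
    · exact ⟨j, by linarith [ha j]⟩
  obtain ⟨ρ₁, D₁, hρ₁, hD₁, hS₁⟩ :=
    exists_spread_tail hm ha hb hT hk₁ (by omega) h1 hpos1 x₀
  obtain ⟨ρ₂, D₂, hρ₂, hD₂, hS₂⟩ := exists_spread_tail hm ha hb hT hk₂ le_rfl h2 hpos2 x₀
  obtain ⟨β, D₃, hβ, hD₃, hZ⟩ :=
    exists_count_tail hm ha hb hT hk₁ hk hk₂ h0 hpos h1 h2 hact x₀
  filter_upwards [eventually_mul_sq_mul_exp_le hε.1 hε.2 hρ₁ D₁,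
    eventually_mul_sq_mul_exp_le hε.1 hε.2 hρ₂ D₂,
    eventually_mul_sq_mul_exp_le (s := 5 * ε) hε.1 (by linarith [hε.1])
      (show 0 < β / 4 by positivity) D₃, eventually_ge_atTop 1] with n he₁ he₂ he₃ hn
  intro Ω _ μ X hX
  have hn1 : (1 : ℝ) ≤ n := by exact_mod_cast hn
  set r := (n : ℝ) ^ γ with hr
  have hr1 : 1 ≤ r := Real.one_le_rpow hn1 hγ.1.le
  set t := (n : ℝ) ^ (1 / 2 + γ + 5 * ε) with ht
  set e := Real.exp (-(n : ℝ) ^ ε) with he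
  have he0 : 0 < e := Real.exp_pos _
  -- Either one of the extreme clouds is spread out at some time up to `n`, or the centres of mass
  -- are often close; each alternative costs at most `e / 3`.
  have hsub : {ω | t < (smallGapCount m a b (X · ω) n r : ℝ)} ⊆
      {ω | ∃ k ∈ Finset.range (n + 1), r < ((atJump (X · ω) k).1 ⟨k₁ - 1, by omega⟩ : ℝ) -
        (atJump (X · ω) k).1 ⟨0, by omega⟩} ∪
      ({ω | ∃ k ∈ Finset.range (n + 1), r < ((atJump (X · ω) k).1 ⟨N - 1, by omega⟩ : ℝ) -
        (atJump (X · ω) k).1 ⟨k₂, hk₂⟩} ∪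
      {ω | t < (((Finset.range (n + 1)).filter fun k =>
            centroidGap m k₁ k₂ (atJump (X · ω) k).1 ≤ 3 * r + 1 - 1).card : ℝ)}) := by
    intro ω hω
    by_contra hcon
    simp only [mem_union, mem_ofPred_eq, not_or, not_exists, not_and, not_lt] at hcon
    obtain ⟨c1, c2, c3⟩ := hcon
    have c4 := smallGapCount_le hm hk₁ hk hk₂ hc hc' n r ω c1 c2
    have c5 : (smallGapCount m a b (X · ω) n r : ℝ) ≤ t := le_trans (by exact_mod_cast c4) c3
    exact absurd hω (not_lt.2 c5)
  have b1 := measure_exists_lt_le (μ := μ) hD₁ (Real.exp_pos (-(ρ₁ * r))).le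
    (fun k ω => r < ((atJump (X · ω) k).1 ⟨k₁ - 1, by omega⟩ : ℝ) -
        (atJump (X · ω) k).1 ⟨0, by omega⟩) (fun k => hS₁ hX k r) n
  have b2 := measure_exists_lt_le (μ := μ) hD₂ (Real.exp_pos (-(ρ₂ * r))).le
    (fun k ω => r < ((atJump (X · ω) k).1 ⟨N - 1, by omega⟩ : ℝ) -
        (atJump (X · ω) k).1 ⟨k₂, hk₂⟩) (fun k => hS₂ hX k r) n
  have b3 := hZ hX n hn (3 * r + 1) (by linarith) t
  have b3' : D₃ * Real.exp (-(β * t / ((3 * r + 1) * Real.sqrt n))) ≤ e / 3 := by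
    refine le_trans ?_ he₃
    have e1 := mul_le_mul_of_nonneg_left (rpow_le_div_mul_sqrt (ε := ε) hγ.1 hn) hβ.le
    have e2 : Real.exp (-(β * t / ((3 * r + 1) * Real.sqrt n))) ≤
        Real.exp (-(β / 4 * (n : ℝ) ^ (5 * ε))) := by
      refine Real.exp_le_exp.2 (neg_le_neg ?_)
      rw [mul_div_assoc]
      linarith
    have e3 : (1 : ℝ) ≤ ((n : ℝ) + 1) ^ 2 := by nlinarith
    calc D₃ * Real.exp (-(β * t / ((3 * r + 1) * Real.sqrt n)))
        ≤ D₃ * Real.exp (-(β / 4 * (n : ℝ) ^ (5 * ε))) := mul_le_mul_of_nonneg_left e2 hD₃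
      _ ≤ D₃ * ((n : ℝ) + 1) ^ 2 * Real.exp (-(β / 4 * (n : ℝ) ^ (5 * ε))) :=
        mul_le_mul_of_nonneg_right (le_mul_of_one_le_right hD₃ e3) (Real.exp_pos _).le
  calc μ {ω | t < (smallGapCount m a b (X · ω) n r : ℝ)}
      ≤ _ := measure_mono hsub
    _ ≤ ENNReal.ofReal (e / 3) + (ENNReal.ofReal (e / 3) + ENNReal.ofReal (e / 3)) :=
        (measure_union_le _ _).trans (add_le_add (b1.trans (ENNReal.ofReal_le_ofReal he₁))
          ((measure_union_le _ _).trans (add_le_add (b2.trans (ENNReal.ofReal_le_ofReal he₂))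
            (b3.trans (ENNReal.ofReal_le_ofReal b3')))))
    _ = ENNReal.ofReal e := by
        rw [← ENNReal.ofReal_add (by positivity) (by positivity),
          ← ENNReal.ofReal_add (by positivity) (by positivity)]
        ring_nf
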